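/- Let $d\ge 1$. For $f\in L^1(\mathbb{R}^d)$ let $\widehat f(\omega)=\int_{\mathbb{R}^d} f(x)e^{-2\pi i\langle x,\omega\rangle}\,dx$, extended as usual to $L^2(\mathbb{R}^d)$ (complex-valued functions), let $|\cdot|$ be the Euclidean norm, and let $\operatorname{supp}$ denote the closed support. For every $n\in\{1,2,\dots\}$ let $\chi_n$ and $g_{\lambda_n}$, $\lambda_n\in\Lambda_n$ ($\Lambda_n$ countable), be functions in $L^1(\mathbb{R}^d)\cap L^2(\mathbb{R}^d)$ and let $A_n,B_n>0$ be such that $$A_n\|f\|_2^2\le \|f\ast\chi_n\|_2^2+\sum_{\lambda_n\in\Lambda_n}\|f\ast g_{\lambda_n}\|_2^2\le B_n\|f\|_2^2\qquad\text{for all } f\in L^2(\mathbb{R}^d).$$ For a path $q=(\lambda_1,\dots,\lambda_n)\in\Lambda^n:=\Lambda_1\times\dots\times\Lambda_n$ put $U[q]f:=U_n[\lambda_n]\cdots U_1[\lambda_1]f$ with $U_k[\lambda_k]f:=|f\ast g_{\lambda_k}|$; for the empty path $e$ put $\Lambda^0:=\{e\}$ and $U[e]f:=f$. Let $$W_N(f):=\sum_{q\in\Lambda^N}\|U[q]f\|_2^2,\qquad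 |||\Phi_\Omega(f)|||^2:=\sum_{n=0}^\infty\sum_{q\in\Lambda^n}\|(U[q]f)\ast\chi_{n+1}\|_2^2,$$ where $\Phi_\Omega(f)$ is the family of all features $(U[q]f)\ast\chi_{n+1}$, $q\in\Lambda^n$, $n\ge0$. Assume that for all $n$ and all $\lambda_n\in\Lambda_n$ there is an orthogonal transformation $R\in O(d)$ with $\operatorname{supp}(\widehat{g_{\lambda_n}})\subseteq\{Rx : x\in\mathbb{R}^d,\ x_k\ge 0 \text{ for } k=1,\dots,d\}$, and that $\delta>0$ (independent of $n$) is such that for all $n$ $$\sum_{\lambda_n\in\Lambda_n}|\widehat{g_{\lambda_n}}(\omega)|^2=0\qquad\text{for a.e. }\omega \text{ with } |\omega|<\delta.$$ Let $A_\Omega^N:=\prod_{k=1}^N\min\{1,A_k\}$, $B_\Omega^N:=\prod_{k=1}^N\max\{1,B_k\}$, and let $\alpha:=1$ if $d=1$ and $\alpha:=\log_2\sqrt{d/(d-1/2)}$ if $d\ge2$. (i) For every real $l>\lfloor d/2\rfloor+1$, every $f\in L^2(\mathbb{R}^d)$ and every $N\ge1$, $$W_N(f)\le B_\Omega^N\int_{\mathbb{R}^d}|\widehat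 f(\omega)|^2\Big(1-\Big|\widehat{r_l}\Big(\frac{\omega}{N^\alpha\delta}\Big)\Big|^2\Big)\,d\omega,\qquad \widehat{r_l}(\omega):=\max\{0,1-|\omega|\}^l .$$ (ii) For every $s>0$ and every $f\in H^s(\mathbb{R}^d)$, i.e. $f\in L^2(\mathbb{R}^d)$ with $\int_{\mathbb{R}^d}(1+|\omega|^2)^s|\widehat f(\omega)|^2\,d\omega<\infty$, we have $W_N(f)=\mathcal{O}(B_\Omega^N N^{-\gamma\alpha})$ with $\gamma:=\min\{1,2s\}$; that is, there are $C>0$ and $N_0$ such that $W_N(f)\le C\,B_\Omega^N N^{-\gamma\alpha}$ for all $N\ge N_0$. (iii) If $A_\Omega^N\to A_\Omega$ and $B_\Omega^N\to B_\Omega$ as $N\to\infty$ with $0<A_\Omega\le B_\Omega<\infty$, then $$A_\Omega\|f\|_2^2\le|||\Phi_\Omega(f)|||^2\le B_\Omega\|f\|_2^2\qquad\text{for all } f\in L^2(\mathbb{R}^d);$$ in particular the null-set $\{f\in L^2(\mathbb{R}^d) : \Phi_\Omega(f)=0\}$ equals $\{0\}$. -/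

import Mathlib

open MeasureTheory Filter Topology
open scoped ENNReal FourierTransform Convolution

/-- `ℝᵈ` with the Euclidean norm. -/
abbrev Rd (d : ℕ) : Type := EuclideanSpace ℝ (Fin d)

/-- The complex space `L²(ℝᵈ)`. -/
abbrev L2 (d : ℕ) : Type := Lp (α := Rd d) ℂ 2 volume

noncomputable section

/-- The convolution `(f ∗ g)(x) = ∫ f(t) g(x - t) dt` of complex functions on `ℝᵈ`. -/
def conv {d : ℕ} (f g : Rd d → ℂ) : Rd d → ℂ :=
  f ⋆[ContinuousLinearMap.mul ℂ ℂ, volume] g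

/-- The energy `‖f‖₂²`, as an extended nonnegative number. -/
def energy {d : ℕ} (f : Rd d → ℂ) : ℝ≥0∞ := eLpNorm f 2 volume ^ 2

/-- The module-sequence `((Ψₙ, |·|, Id))ₙ` on `ℝᵈ`. Layers are numbered from `0` here, so that the
index `n` stands for layer `n + 1`. Layer `n` carries an output-generating filter `χ n` and filters
`g n lam`, for `lam` in the countable set `Λ n`, all in `L¹ ∩ L²`, with frame bounds
`A n, B n > 0`. -/
structure ModuleSequence (d : ℕ) where
  /-- the index sets of the filters -/
  Λ : ℕ → Type
  countable_index : ∀ n, Countable (Λ n)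
  /-- the output-generating filters -/
  χ : ℕ → Rd d → ℂ
  /-- the remaining filters -/
  g : (n : ℕ) → Λ n → Rd d → ℂ
  /-- the lower frame bounds -/
  A : ℕ → ℝ
  /-- the upper frame bounds -/
  B : ℕ → ℝ
  integrable_χ : ∀ n, Integrable (χ n) volume
  memLp_χ : ∀ n, MemLp (χ n) 2 volume
  integrable_g : ∀ n lam, Integrable (g n lam) volume
  memLp_g : ∀ n lam, MemLp (g n lam) 2 volume
  A_pos : ∀ n, 0 < A n
  B_pos : ∀ n, 0 < B n
  frame_lower : ∀ n (f : L2 d), ENNReal.ofReal (A n) * energy (f : Rd d → ℂ) ≤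
    energy (conv f (χ n)) + ∑' lam : Λ n, energy (conv f (g n lam))
  frame_upper : ∀ n (f : L2 d),
    energy (conv f (χ n)) + ∑' lam : Λ n, energy (conv f (g n lam)) ≤
      ENNReal.ofReal (B n) * energy (f : Rd d → ℂ)

/-- The first canonical orthant of `ℝᵈ`. -/
def orthant (d : ℕ) : Set (Rd d) := {x | ∀ k, 0 ≤ x k}

namespace ModuleSequence

variable {d : ℕ} (Ω : ModuleSequence d)

/-- The paths `Λ^N = Λ₁ × ⋯ × Λ_N` of length `N`. -/
abbrev Path (N : ℕ) : Type := (k : Fin N) → Ω.Λ k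

/-- The feature map `U[q] f`: starting from `f`, convolve successively with the filters
indexed by the path `q` and take the modulus after each convolution. -/
def U : (N : ℕ) → Ω.Path N → (Rd d → ℂ) → (Rd d → ℂ)
  | 0, _, f => f
  | N + 1, q, f => fun x =>
      ((‖conv (U N (fun k => q k.castSucc) f) (Ω.g N (q (Fin.last N))) x‖ : ℝ) : ℂ)

/-- The feature `(U[q] f) ∗ χ_{n+1}` generated by the path `q` in layer `n`. -/
def feature (n : ℕ) (q : Ω.Path n) (f : Rd d → ℂ) : Rd d → ℂ :=
  conv (Ω.U n q f) (Ω.χ n)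

/-- The feature map energy `W_N(f) = ∑_{q ∈ Λ^N} ‖U[q] f‖₂²`. -/
def W (N : ℕ) (f : Rd d → ℂ) : ℝ≥0∞ := ∑' q : Ω.Path N, energy (Ω.U N q f)

/-- The squared norm `|||Φ_Ω(f)|||² = ∑ₙ ∑_{q ∈ Λⁿ} ‖(U[q] f) ∗ χ_{n+1}‖₂²` of the feature
vector. -/
def featureEnergy (f : Rd d → ℂ) : ℝ≥0∞ :=
  ∑' n : ℕ, ∑' q : Ω.Path n, energy (Ω.feature n q f)

/-- The null-set of the feature extractor: the signals all of whose features vanish. -/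
def nullSet : Set (L2 d) := {f | ∀ (n : ℕ) (q : Ω.Path n), Ω.feature n q f =ᵐ[volume] 0}

/-- Analyticity of the filters: the Fourier transform of every filter `g n lam` is supported in a
rotated orthant `{R x | x ∈ orthant d}`, where `R` is an orthogonal transformation. -/
def Analytic : Prop :=
  ∀ n (lam : Ω.Λ n), ∃ R : Rd d ≃ₗᵢ[ℝ] Rd d, tsupport (𝓕 (Ω.g n lam)) ⊆ R '' orthant d

/-- High-pass condition: in every layer the filters `g n lam` leave the spectral gap `B_δ(0)`. -/
def HighPass (δ : ℝ) : Prop :=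
  ∀ n, ∀ᵐ ω ∂(volume : Measure (Rd d)), ω ∈ Metric.ball (0 : Rd d) δ →
    ∑' lam : Ω.Λ n, ‖𝓕 (Ω.g n lam) ω‖ₑ ^ 2 = 0

/-- `A_Ω^N = ∏_{k=1}^N min {1, A_k}`. -/
def lowerBound (N : ℕ) : ℝ := ∏ k ∈ Finset.range N, min 1 (Ω.A k)

/-- `B_Ω^N = ∏_{k=1}^N max {1, B_k}`. -/
def upperBound (N : ℕ) : ℝ := ∏ k ∈ Finset.range N, max 1 (Ω.B k)

end ModuleSequence

/-- The decay exponent `α`. -/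
def decayExponent (d : ℕ) : ℝ :=
  if d = 1 then 1 else Real.logb 2 (Real.sqrt ((d : ℝ) / ((d : ℝ) - 1 / 2)))

/-- The function `r̂_l(ω) = (1 - |ω|)_+^l`. -/
def rHat {d : ℕ} (l : ℝ) (ω : Rd d) : ℝ := (max 0 (1 - ‖ω‖)) ^ l

/-- Membership of `f ∈ L²(ℝᵈ)` in the Sobolev space `H^s(ℝᵈ)`: the integral
`∫ (1 + |ω|²)^s |f̂(ω)|² dω` is finite. -/
def MemHs {d : ℕ} (s : ℝ) (f : L2 d) : Prop :=
  ∫⁻ ω, ENNReal.ofReal ((1 + ‖ω‖ ^ 2) ^ s) * ‖(𝓕 f : L2 d) ω‖ₑ ^ 2 < ⊤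

end

/-! ### The `L²` Fourier transform and the Fourier integral -/

section FourierL2

open scoped SchwartzMap ContDiff ComplexConjugate RealInnerProductSpace

variable {V : Type*} [NormedAddCommGroup V] [InnerProductSpace ℝ V] [MeasurableSpace V]
  [BorelSpace V] [FiniteDimensional ℝ V]

/-! The modulus moves spectral energy towards the origin. Let `k` be a spectral weight with
nonnegative Fourier transform. By Parseval, `∫ |F̂|² k(· - ν)` pairs the autocorrelation of `F` with
a modulated nonnegative function. The autocorrelation of `F` is dominated by that of `|F|`, so the
integral is at most the unshifted one for `|F|` (`norm_integral_powerSpectrum_mul_le`). As the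
modulus preserves energy, the inequality reverses for the high-pass weight `1 - k`
(`spectralEnergy_modulus_le`).

The weight `(1 - |ω|/R)₊^(2l)` qualifies because it is a positive multiple of `∫ min (M x) (M (x -
ω)) dx` for a radial decreasing `M`, that is, a mixture of autocorrelations of the superlevel sets
of `M`. Splitting space at the bisecting hyperplane of `0` and `ω` turns this integral into a tail
of the `(d-1)`-fold line integral of the profile of `M`. The profile is then found by inverting
pairs of line integrals, which amounts to applying `-(1/(2πρ)) d/dρ` (`modulusMonotone_rHat_sq`).

The shift `ν` is free, and analyticity exploits this. A spectrum in a rotated orthant outside the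
ball of radius `δ` comes closer to the origin when shifted along the diagonal of the orthant, by
enough to pay for replacing the radius `(N+1)^α δ` by `N^α δ` (`exists_shift`). Hence each layer,
read from the last to the first, raises the index of the high-pass weight by one at the cost of a
factor `max {1, B}`. The last layer starts the recursion: its filters vanish on the spectral gap,
where alone the weight of index `1` differs from `1`.

The decay rate follows by comparing the weight with `(1 + |ω|²)^s` through Bernoulli's inequality.
For the frame bounds, the inequalities of the layers telescope, and the remainder `W_N` tends to
zero by dominated convergence. -/

theorem integral_mul_fourier_eq {f g : V → ℂ} (hf : Integrable f) (hg : Integrable g) :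
    ∫ x, 𝓕 g x * f x = ∫ x, g x * 𝓕 f x := by
  have h := VectorFourier.integral_fourierIntegral_smul_eq_flip (f := g) (g := f)
    (μ := (volume : Measure V)) (ν := (volume : Measure V)) (L := innerₗ V)
    Real.continuous_fourierChar continuous_inner hg hf
  have hflip : (innerₗ V).flip = innerₗ V := by
    ext x y; simp
  rw [hflip] at h
  exact h

theorem integral_mul_fourierInv_eq {f g : V → ℂ} (hf : Integrable f) (hg : Integrable g) :
    ∫ x, 𝓕⁻ g x * f x = ∫ x, g x * 𝓕⁻ f x := by
  have h := integral_mul_fourier_eq hf.comp_neg hg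
  simp only [Real.fourierInv_eq_fourier_neg g, Real.fourierInv_eq_fourier_comp_neg f]
  rw [← h, ← integral_neg_eq_self]
  simp

theorem continuous_fourier_of_integrable {f : V → ℂ} (hf : Integrable f) : Continuous (𝓕 f) :=
  VectorFourier.fourierIntegral_continuous Real.continuous_fourierChar
    (L := innerₗ V) continuous_inner hf

theorem continuous_fourierInv_of_integrable {f : V → ℂ} (hf : Integrable f) :
    Continuous (𝓕⁻ f) := by
  have : 𝓕⁻ f = fun w => 𝓕 f (-w) := funext (Real.fourierInv_eq_fourier_neg f)
  rw [this]
  exact (continuous_fourier_of_integrable hf).comp continuous_neg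

/-- On `L¹ ∩ L²` the `L²` Fourier transform is given by the Fourier integral. -/
theorem coeFn_fourier_toLp {f : V → ℂ} (hf : Integrable f) (hf2 : MemLp f 2) :
    (𝓕 (hf2.toLp f) : Lp (α := V) ℂ 2 volume) =ᵐ[volume] 𝓕 f := by
  -- The `L²` transform is accessible as a tempered distribution, so both sides are compared by
  -- testing against smooth compactly supported functions.
  refine ae_eq_of_integral_contDiff_smul_eq ?_ ?_ fun g hg hgs => ?_
  · exact (Lp.memLp _).locallyIntegrable (by norm_num)
  · exact (continuous_fourier_of_integrable hf).locallyIntegrable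
  have hgs' : HasCompactSupport fun x => (g x : ℂ) := hgs.comp_left (g := ((↑) : ℝ → ℂ)) rfl
  have hg' : ContDiff ℝ ∞ fun x => (g x : ℂ) := Complex.ofRealCLM.contDiff.comp hg
  let φ : 𝓢(V, ℂ) := hgs'.toSchwartzMap hg'
  have h := congrArg (fun T => T φ) (Lp.fourier_toTemperedDistribution_eq (hf2.toLp f))
  simp only [TemperedDistribution.fourier_apply, Lp.toTemperedDistribution_apply,
    smul_eq_mul] at h
  have h1 : ∫ x, (𝓕 φ) x * (hf2.toLp f) x = ∫ x, 𝓕 (φ : V → ℂ) x * f x := by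
    refine integral_congr_ae ?_
    filter_upwards [hf2.coeFn_toLp] with x hx
    rw [hx, SchwartzMap.fourier_coe]
  rw [h1, integral_mul_fourier_eq hf φ.integrable] at h
  simpa [φ] using h.symm

/-- On `L¹ ∩ L²` the inverse `L²` Fourier transform is given by the inverse Fourier integral. -/
theorem coeFn_fourierInv_toLp {f : V → ℂ} (hf : Integrable f) (hf2 : MemLp f 2) :
    (𝓕⁻ (hf2.toLp f) : Lp (α := V) ℂ 2 volume) =ᵐ[volume] 𝓕⁻ f := by
  refine ae_eq_of_integral_contDiff_smul_eq ?_ ?_ fun g hg hgs => ?_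
  · exact (Lp.memLp _).locallyIntegrable (by norm_num)
  · exact (continuous_fourierInv_of_integrable hf).locallyIntegrable
  have hgs' : HasCompactSupport fun x => (g x : ℂ) := hgs.comp_left (g := ((↑) : ℝ → ℂ)) rfl
  have hg' : ContDiff ℝ ∞ fun x => (g x : ℂ) := Complex.ofRealCLM.contDiff.comp hg
  let φ : 𝓢(V, ℂ) := hgs'.toSchwartzMap hg'
  have h := congrArg (fun T => T φ) (Lp.fourierInv_toTemperedDistribution_eq (hf2.toLp f))
  simp only [TemperedDistribution.fourierInv_apply, Lp.toTemperedDistribution_apply,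
    smul_eq_mul] at h
  have h1 : ∫ x, (𝓕⁻ φ) x * (hf2.toLp f) x = ∫ x, 𝓕⁻ (φ : V → ℂ) x * f x := by
    refine integral_congr_ae ?_
    filter_upwards [hf2.coeFn_toLp] with x hx
    rw [hx, SchwartzMap.fourierInv_coe]
  rw [h1, integral_mul_fourierInv_eq hf φ.integrable] at h
  simpa [φ] using h.symm

theorem fourier_conj (k : V → ℂ) (w : V) : 𝓕 (fun x => conj (k x)) w = conj (𝓕⁻ k w) := by
  rw [Real.fourier_eq', Real.fourierInv_eq', ← integral_conj]
  congr with x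
  simp only [smul_eq_mul, map_mul, ← Complex.exp_conj]
  congr 2
  simpa using Or.inl (Complex.conj_ofReal 2).symm

theorem fourierInv_conj (k : V → ℂ) (w : V) : 𝓕⁻ (fun x => conj (k x)) w = conj (𝓕 k w) := by
  rw [Real.fourier_eq', Real.fourierInv_eq', ← integral_conj]
  congr with x
  simp only [smul_eq_mul, map_mul, ← Complex.exp_conj]
  congr 2
  simpa using Or.inl (Complex.conj_ofReal 2).symm

theorem MeasureTheory.MemLp.conj_complex {k : V → ℂ} {p : ℝ≥0∞} (hk : MemLp k p) :
    MemLp (fun x => conj (k x)) p :=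
  hk.star

theorem MeasureTheory.Integrable.conj_complex {k : V → ℂ} (hk : Integrable k) :
    Integrable (fun x => conj (k x)) := by
  rw [← memLp_one_iff_integrable] at *
  exact hk.conj_complex

/-- Parseval's identity in bilinear form, for `f ∈ L²` and `k ∈ L¹ ∩ L²`. -/
theorem integral_mul_eq_integral_fourier_mul (f : Lp (α := V) ℂ 2 volume) {k : V → ℂ}
    (hk : Integrable k) (hk2 : MemLp k 2) :
    ∫ x, f x * k x = ∫ w, (𝓕 f : Lp (α := V) ℂ 2 volume) w * 𝓕⁻ k w := by
  have h := Lp.inner_fourier_eq (hk2.conj_complex.toLp _) f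
  rw [L2.inner_def, L2.inner_def] at h
  have e1 : ∫ x, f x * k x = ∫ x, inner ℂ ((hk2.conj_complex.toLp _) x) (f x) := by
    refine integral_congr_ae ?_
    filter_upwards [hk2.conj_complex.coeFn_toLp] with x hx
    rw [hx]; simp
  rw [e1, ← h]
  refine integral_congr_ae ?_
  filter_upwards [coeFn_fourier_toLp hk.conj_complex hk2.conj_complex] with x hx
  rw [hx, fourier_conj]; simp

/-- Multiplication formula for `f ∈ L²` and `k ∈ L¹ ∩ L²`. -/
theorem integral_fourier_mul_eq_integral_mul (f : Lp (α := V) ℂ 2 volume) {k : V → ℂ}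
    (hk : Integrable k) (hk2 : MemLp k 2) :
    ∫ w, (𝓕 f : Lp (α := V) ℂ 2 volume) w * k w = ∫ x, f x * 𝓕 k x := by
  -- Parseval is applied to the inverse transform of `conj k`, so that `k` ends up on the frequency
  -- side.
  have h := Lp.inner_fourier_eq (𝓕⁻ (hk2.conj_complex.toLp _) : Lp (α := V) ℂ 2 volume) f
  rw [FourierTransform.fourier_fourierInv_eq, L2.inner_def, L2.inner_def] at h
  have e1 : ∫ x, (𝓕 f : Lp (α := V) ℂ 2 volume) x * k x =
      ∫ x, inner ℂ ((hk2.conj_complex.toLp _) x) ((𝓕 f : Lp (α := V) ℂ 2 volume) x) := by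
    refine integral_congr_ae ?_
    filter_upwards [hk2.conj_complex.coeFn_toLp] with x hx
    rw [hx]; simp
  rw [e1, h]
  refine integral_congr_ae ?_
  filter_upwards [coeFn_fourierInv_toLp hk.conj_complex hk2.conj_complex] with x hx
  rw [hx, fourierInv_conj]; simp

end FourierL2

/-! ### Translations and autocorrelation -/

section Translation

open scoped SchwartzMap ContDiff ComplexConjugate RealInnerProductSpace

variable {V : Type*} [NormedAddCommGroup V] [InnerProductSpace ℝ V] [MeasurableSpace V]
  [BorelSpace V] [FiniteDimensional ℝ V]

theorem MeasureTheory.MemLp.translate {F : V → ℂ} {p : ℝ≥0∞} (hF : MemLp F p) (x : V) :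
    MemLp (fun t => F (t - x)) p :=
  hF.comp_measurePreserving (measurePreserving_sub_right volume x)

theorem fourier_fourierChar_mul (k : V → ℂ) (x t : V) :
    𝓕 (fun w => (Real.fourierChar (-⟪x, w⟫) : ℂ) * k w) t = 𝓕 k (t + x) := by
  simp only [Real.fourier_eq, Circle.smul_def, smul_eq_mul]
  congr with w
  rw [← mul_assoc, inner_add_right, neg_add, AddChar.map_add_eq_mul, real_inner_comm x w]
  simp

theorem norm_fourierChar_mul (a : ℝ) (z : ℂ) : ‖(Real.fourierChar a : ℂ) * z‖ = ‖z‖ := by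
  rw [norm_mul, Circle.norm_coe, one_mul]

theorem continuous_fourierChar_inner {V : Type*} [NormedAddCommGroup V] [InnerProductSpace ℝ V]
    (x : V) :
    Continuous fun w : V => (Real.fourierChar (-⟪x, w⟫) : ℂ) := by
  fun_prop

theorem MeasureTheory.MemLp.fourierChar_mul {F : V → ℂ} {p : ℝ≥0∞} (hF : MemLp F p) (x : V) :
    MemLp (fun w => (Real.fourierChar (-⟪x, w⟫) : ℂ) * F w) p :=
  (memLp_congr_norm ((continuous_fourierChar_inner x).aestronglyMeasurable.mul hF.1) hF.1
    (ae_of_all _ fun _ => norm_fourierChar_mul _ _)).2 hF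

/-- The `L²` Fourier transform turns translations into modulations. -/
theorem coeFn_fourier_translate (F : Lp (α := V) ℂ 2 volume) (x : V) :
    (𝓕 (((Lp.memLp F).translate x).toLp _) : Lp (α := V) ℂ 2 volume) =ᵐ[volume]
      fun w => (Real.fourierChar (-⟪x, w⟫) : ℂ) * (𝓕 F : Lp (α := V) ℂ 2 volume) w := by
  refine ae_eq_of_integral_contDiff_smul_eq ?_ ?_ fun g hg hgs => ?_
  · exact (Lp.memLp _).locallyIntegrable (by norm_num)
  · exact ((Lp.memLp _).fourierChar_mul x).locallyIntegrable (by norm_num)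
  have hgs' : HasCompactSupport fun x => (g x : ℂ) := hgs.comp_left (g := ((↑) : ℝ → ℂ)) rfl
  have hgc : Continuous fun x => (g x : ℂ) := Complex.continuous_ofReal.comp hg.continuous
  have h1 : MemLp (fun x => (g x : ℂ)) 1 := hgc.memLp_of_hasCompactSupport hgs'
  have h2 : MemLp (fun x => (g x : ℂ)) 2 := hgc.memLp_of_hasCompactSupport hgs'
  have e1 := integral_fourier_mul_eq_integral_mul (((Lp.memLp F).translate x).toLp _)
    (memLp_one_iff_integrable.1 h1) h2
  have e2 := integral_fourier_mul_eq_integral_mul F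
    (memLp_one_iff_integrable.1 (h1.fourierChar_mul x)) (h2.fourierChar_mul x)
  have e3 : ∫ t, (((Lp.memLp F).translate x).toLp _) t * 𝓕 (fun x => (g x : ℂ)) t =
      ∫ t, F t * 𝓕 (fun w => (Real.fourierChar (-⟪x, w⟫) : ℂ) * (g w : ℂ)) t := by
    simp only [fourier_fourierChar_mul]
    rw [← integral_sub_right_eq_self (fun t => F t * 𝓕 (fun x => (g x : ℂ)) (t + x)) x]
    refine integral_congr_ae ?_
    filter_upwards [((Lp.memLp F).translate x).coeFn_toLp] with t ht
    rw [ht]; simp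
  rw [e3, ← e2] at e1
  simp only [Complex.real_smul]
  calc _ = _ := integral_congr_ae (ae_of_all _ fun w => mul_comm _ _)
    _ = _ := e1
    _ = _ := integral_congr_ae (ae_of_all _ fun w => by ring)

/-- The autocorrelation of an `L²` function is the Fourier integral of its power spectrum. -/
theorem integral_mul_conj_translate (F : Lp (α := V) ℂ 2 volume) (x : V) :
    ∫ t, conj (F t) * F (t - x) = ∫ w, (Real.fourierChar (-⟪x, w⟫) : ℂ) *
      ((‖(𝓕 F : Lp (α := V) ℂ 2 volume) w‖ ^ 2 : ℝ) : ℂ) := by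
  have h := Lp.inner_fourier_eq F (((Lp.memLp F).translate x).toLp _)
  rw [L2.inner_def, L2.inner_def] at h
  have e1 : ∫ t, conj (F t) * F (t - x) =
      ∫ t, inner ℂ (F t) ((((Lp.memLp F).translate x).toLp _) t) := by
    refine integral_congr_ae ?_
    filter_upwards [((Lp.memLp F).translate x).coeFn_toLp] with t ht
    rw [ht]; simp [mul_comm]
  rw [e1, ← h]
  refine integral_congr_ae ?_
  filter_upwards [coeFn_fourier_translate F x] with t ht
  rw [ht]
  simp only [RCLike.inner_apply]
  rw [mul_assoc, Complex.mul_conj, Complex.normSq_eq_norm_sq]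

end Translation

/-! ### The convolution theorem on `L²` -/

section Convolution

open scoped SchwartzMap ContDiff ComplexConjugate RealInnerProductSpace

variable {d : ℕ}

theorem MeasureTheory.Lp.memLp_two (f : L2 d) : MemLp f 2 volume := Lp.memLp f

theorem norm_fourier_le_integral_norm (g : Rd d → ℂ) (w : Rd d) : ‖𝓕 g w‖ ≤ ∫ x, ‖g x‖ :=
  VectorFourier.norm_fourierIntegral_le_integral_norm _ _ _ _ _

theorem memLp_mul_fourier {f g : Rd d → ℂ} (hf : MemLp f 2 volume) (hg : Integrable g) :
    MemLp (fun w => f w * 𝓕 g w) 2 volume := by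
  refine (hf.norm.const_mul (∫ x, ‖g x‖)).mono'
    (hf.1.mul (continuous_fourier_of_integrable hg).aestronglyMeasurable) (ae_of_all _ fun w => ?_)
  rw [norm_mul, mul_comm]
  exact mul_le_mul_of_nonneg_right (norm_fourier_le_integral_norm g w) (norm_nonneg _)

theorem memLp_fourier {g : Rd d → ℂ} (hg : Integrable g) (hg2 : MemLp g 2 volume) :
    MemLp (𝓕 g) 2 volume :=
  (memLp_congr_ae (coeFn_fourier_toLp hg hg2)).1 (Lp.memLp _)

theorem integrable_mul_fourier {f g : Rd d → ℂ} (hf : MemLp f 2 volume) (hg : Integrable g)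
    (hg2 : MemLp g 2 volume) : Integrable fun w => f w * 𝓕 g w :=
  hf.integrable_mul (memLp_fourier hg hg2)

/-- Parseval for `f` and `t ↦ g (x - t)`, whose inverse transform is a modulation of `𝓕 g`. The
identity holds at every point `x`, not just almost everywhere. -/
theorem conv_eq_fourierInv (f : L2 d) {g : Rd d → ℂ} (hg : Integrable g)
    (hg2 : MemLp g 2 volume) :
    conv f g = 𝓕⁻ (fun w => (𝓕 f : L2 d) w * 𝓕 g w) := by
  ext x
  have hp : MeasurePreserving (fun t : Rd d => x - t) volume volume :=
    Measure.measurePreserving_sub_left volume x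
  have h := integral_mul_eq_integral_fourier_mul f
    (memLp_one_iff_integrable.1 ((memLp_one_iff_integrable.2 hg).comp_measurePreserving hp))
    (hg2.comp_measurePreserving hp)
  have hk (w : Rd d) : 𝓕⁻ (g ∘ fun t => x - t) w = (Real.fourierChar ⟪w, x⟫ : ℂ) * 𝓕 g w := by
    rw [Real.fourierInv_eq, Real.fourier_eq, ← integral_sub_left_eq_self _ volume x,
      ← integral_const_mul]
    congr with t
    simp only [Function.comp_apply, sub_sub_cancel, Circle.smul_def, smul_eq_mul,
      ← mul_assoc, ← Circle.coe_mul, ← AddChar.map_add_eq_mul]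
    rw [inner_sub_left, real_inner_comm w x, sub_eq_add_neg]
  simp only [hk, Function.comp_apply] at h
  rw [conv, convolution_def, Real.fourierInv_eq]
  refine h.trans (integral_congr_ae (ae_of_all _ fun w => ?_))
  simp only [Circle.smul_def, smul_eq_mul]
  ring

theorem coeFn_fourierInv_mul_fourier (f : L2 d) {g : Rd d → ℂ} (hg : Integrable g)
    (hg2 : MemLp g 2 volume) :
    (𝓕⁻ ((memLp_mul_fourier (Lp.memLp_two (𝓕 f)) hg).toLp _) : L2 d) =ᵐ[volume] conv f g := by
  rw [conv_eq_fourierInv f hg hg2]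
  exact coeFn_fourierInv_toLp (integrable_mul_fourier (Lp.memLp_two _) hg hg2) _

theorem memLp_conv_coe (f : L2 d) {g : Rd d → ℂ} (hg : Integrable g)
    (hg2 : MemLp g 2 volume) : MemLp (conv f g) 2 volume :=
  (memLp_congr_ae (coeFn_fourierInv_mul_fourier f hg hg2)).1 (Lp.memLp_two _)

/-- The convolution theorem for `f ∈ L²` and `g ∈ L¹ ∩ L²`. -/
theorem coeFn_fourier_conv (f : L2 d) {g : Rd d → ℂ} (hg : Integrable g)
    (hg2 : MemLp g 2 volume) :
    (𝓕 ((memLp_conv_coe f hg hg2).toLp _) : L2 d) =ᵐ[volume]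
      fun w => (𝓕 f : L2 d) w * 𝓕 g w := by
  have h : (memLp_conv_coe f hg hg2).toLp _ =
      (𝓕⁻ ((memLp_mul_fourier (Lp.memLp_two (𝓕 f)) hg).toLp _) : L2 d) := by
    rw [← Lp.toLp_coeFn (𝓕⁻ ((memLp_mul_fourier (Lp.memLp_two (𝓕 f)) hg).toLp _) : L2 d)
      (Lp.memLp _), MemLp.toLp_eq_toLp_iff]
    exact (coeFn_fourierInv_mul_fourier f hg hg2).symm
  rw [h, FourierTransform.fourier_fourierInv_eq]
  exact MemLp.coeFn_toLp _

theorem conv_congr_left {f f' : Rd d → ℂ} (h : f =ᵐ[volume] f') (g : Rd d → ℂ) :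
    conv f g = conv f' g :=
  convolution_congr _ h EventuallyEq.rfl

theorem memLp_conv {f g : Rd d → ℂ} (hf : MemLp f 2 volume) (hg : Integrable g)
    (hg2 : MemLp g 2 volume) : MemLp (conv f g) 2 volume := by
  rw [← conv_congr_left hf.coeFn_toLp]
  exact memLp_conv_coe _ hg hg2

theorem energy_eq_lintegral (f : Rd d → ℂ) : energy f = ∫⁻ x, ‖f x‖ₑ ^ 2 := by
  rw [energy, eLpNorm_eq_lintegral_rpow_enorm_toReal (by norm_num) (by norm_num),
    ← ENNReal.rpow_natCast, ← ENNReal.rpow_mul]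
  norm_num

theorem energy_congr_ae {f f' : Rd d → ℂ} (h : f =ᵐ[volume] f') : energy f = energy f' := by
  rw [energy, energy, eLpNorm_congr_ae h]

theorem energy_ne_top {f : Rd d → ℂ} (hf : MemLp f 2 volume) : energy f ≠ ⊤ :=
  ENNReal.pow_ne_top hf.2.ne

/-- Plancherel's theorem. -/
theorem energy_fourier (f : L2 d) : energy (𝓕 f : L2 d) = energy f := by
  have h := Lp.norm_fourier_eq f
  rw [Lp.norm_def, Lp.norm_def, ENNReal.toReal_eq_toReal_iff' (Lp.eLpNorm_ne_top _)
    (Lp.eLpNorm_ne_top _)] at h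
  rw [energy, energy, h]

theorem energy_conv_coe (f : L2 d) {g : Rd d → ℂ} (hg : Integrable g)
    (hg2 : MemLp g 2 volume) :
    energy (conv f g) = ∫⁻ w, ‖(𝓕 f : L2 d) w‖ₑ ^ 2 * ‖𝓕 g w‖ₑ ^ 2 := by
  rw [← energy_congr_ae (memLp_conv_coe f hg hg2).coeFn_toLp, ← energy_fourier,
    energy_congr_ae (coeFn_fourier_conv f hg hg2), energy_eq_lintegral]
  simp [mul_pow]

end Convolution

/-! ### Spectral weights for which the modulus gains low-frequency energy -/

section ModulusMonotone

open scoped ComplexConjugate RealInnerProductSpace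

variable {V : Type*} [NormedAddCommGroup V] [InnerProductSpace ℝ V] [MeasurableSpace V]
  [BorelSpace V] [FiniteDimensional ℝ V]

theorem MeasureTheory.MemLp.ofReal_norm {α : Type*} [MeasurableSpace α] {μ : Measure α}
    {F : α → ℂ} {p : ℝ≥0∞} (hF : MemLp F p μ) : MemLp (fun x => ((‖F x‖ : ℝ) : ℂ)) p μ :=
  hF.norm.ofReal

/-- The modulus of an `L²` function, as an `L²` function. -/
noncomputable def modulus (F : Lp (α := V) ℂ 2 volume) : Lp (α := V) ℂ 2 volume :=
  (Lp.memLp F).ofReal_norm.toLp _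

/-- The power spectrum `|F̂|²` of an `L²` function. -/
noncomputable def powerSpectrum (F : Lp (α := V) ℂ 2 volume) (w : V) : ℝ :=
  ‖(𝓕 F : Lp (α := V) ℂ 2 volume) w‖ ^ 2

theorem integrable_powerSpectrum (F : Lp (α := V) ℂ 2 volume) : Integrable (powerSpectrum F) :=
  (memLp_two_iff_integrable_sq_norm (Lp.memLp _).1).1 (Lp.memLp _)

theorem integrable_powerSpectrum_complex (F : Lp (α := V) ℂ 2 volume) :
    Integrable fun w => (powerSpectrum F w : ℂ) :=
  (integrable_powerSpectrum F).ofReal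

theorem autocorrelation_eq_fourier (F : Lp (α := V) ℂ 2 volume) (x : V) :
    ∫ t, conj (F t) * F (t - x) = 𝓕 (fun w => (powerSpectrum F w : ℂ)) x := by
  rw [integral_mul_conj_translate, Real.fourier_eq]
  congr with w
  rw [real_inner_comm, Circle.smul_def, smul_eq_mul, powerSpectrum]

theorem integral_powerSpectrum_mul (F h : Lp (α := V) ℂ 2 volume) (ν : V) :
    ∫ w, (powerSpectrum F w : ℂ) * 𝓕 (fun x => (powerSpectrum h x : ℂ)) (w - ν) =
      ∫ x, 𝓕 (fun w => (powerSpectrum F w : ℂ)) x *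
        ((Real.fourierChar (-⟪-ν, x⟫) : ℂ) * (powerSpectrum h x : ℂ)) := by
  have hQ : Integrable fun x => (Real.fourierChar (-⟪-ν, x⟫) : ℂ) * (powerSpectrum h x : ℂ) :=
    memLp_one_iff_integrable.1
      ((memLp_one_iff_integrable.2 (integrable_powerSpectrum_complex h)).fourierChar_mul (-ν))
  rw [integral_mul_fourier_eq hQ (integrable_powerSpectrum_complex F)]
  congr with w
  rw [fourier_fourierChar_mul, sub_eq_add_neg]

theorem fourier_powerSpectrum_modulus (F : Lp (α := V) ℂ 2 volume) (x : V) :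
    𝓕 (fun w => (powerSpectrum (modulus F) w : ℂ)) x =
      ((∫ t, ‖F t‖ * ‖F (t - x)‖ : ℝ) : ℂ) := by
  rw [← autocorrelation_eq_fourier, ← integral_complex_ofReal]
  refine integral_congr_ae ?_
  have h := (Lp.memLp F).ofReal_norm.coeFn_toLp
  filter_upwards [h, (measurePreserving_sub_right volume x).quasiMeasurePreserving.ae h]
    with t ht ht'
  rw [modulus, ht, ht']
  simp

/-- Triangle inequality in the autocorrelation of `F`; by `fourier_powerSpectrum_modulus` the bound
is the autocorrelation of `|F|`. This is what discarding the phase gains. -/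
theorem norm_fourier_powerSpectrum_le (F : Lp (α := V) ℂ 2 volume) (x : V) :
    ‖𝓕 (fun w => (powerSpectrum F w : ℂ)) x‖ ≤ ∫ t, ‖F t‖ * ‖F (t - x)‖ := by
  rw [← autocorrelation_eq_fourier]
  refine (norm_integral_le_integral_norm _).trans_eq ?_
  simp

theorem integrable_mul_fourier_of_integrable {f g : V → ℂ} (hf : Integrable f)
    (hg : Integrable g) (x : V) : Integrable fun w => f w * 𝓕 g (w - x) :=
  hf.mul_bdd (c := ∫ x, ‖g x‖)
    ((continuous_fourier_of_integrable hg).comp (continuous_sub_right x)).aestronglyMeasurable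
    (ae_of_all _ fun _ => VectorFourier.norm_fourierIntegral_le_integral_norm _ _ _ _ _)

/-- After the multiplication formula the translation by `ν` is a unimodular factor, which disappears
in absolute value. The power spectrum of `h` is nonnegative, so the pointwise domination of
autocorrelations can be integrated against it. -/
theorem norm_integral_powerSpectrum_mul_le (F h : Lp (α := V) ℂ 2 volume) (ν : V) :
    ‖∫ w, (powerSpectrum F w : ℂ) * 𝓕 (fun x => (powerSpectrum h x : ℂ)) (w - ν)‖ ≤
      ‖∫ w, (powerSpectrum (modulus F) w : ℂ) * 𝓕 (fun x => (powerSpectrum h x : ℂ)) w‖ := by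
  have hQ0 (x : V) : 0 ≤ powerSpectrum h x := sq_nonneg _
  have e := integral_powerSpectrum_mul (modulus F) h 0
  simp only [sub_zero, neg_zero, inner_zero_left, AddChar.map_zero_eq_one, Circle.coe_one,
    one_mul, fourier_powerSpectrum_modulus, ← Complex.ofReal_mul] at e
  rw [integral_powerSpectrum_mul, e, integral_complex_ofReal, Complex.norm_real]
  refine (norm_integral_le_of_norm_le ?_ (ae_of_all _ fun x => ?_)).trans (le_abs_self _)
  · have := integrable_mul_fourier_of_integrable (integrable_powerSpectrum_complex h)
      (integrable_powerSpectrum_complex (modulus F)) 0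
    simp only [sub_zero, fourier_powerSpectrum_modulus, ← Complex.ofReal_mul] at this
    simpa [mul_comm] using this.re
  · rw [norm_mul, norm_fourierChar_mul, Complex.norm_real, Real.norm_of_nonneg (hQ0 x)]
    exact mul_le_mul_of_nonneg_right (norm_fourier_powerSpectrum_le F x) (hQ0 x)

/-- A spectral weight `k` is modulus monotone if the `k`-weighted spectral energy of `|F|` is at
least the spectral energy of `F` weighted by any translate of `k`. -/
def ModulusMonotone (k : V → ℝ≥0∞) : Prop :=
  ∀ (F : Lp (α := V) ℂ 2 volume) (ν : V),
    ∫⁻ w, ‖(𝓕 F : Lp (α := V) ℂ 2 volume) w‖ₑ ^ 2 * k (w - ν) ≤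
      ∫⁻ w, ‖(𝓕 (modulus F) : Lp (α := V) ℂ 2 volume) w‖ₑ ^ 2 * k w

theorem enorm_sq_eq_ofReal (z : ℂ) : ‖z‖ₑ ^ 2 = ENNReal.ofReal (‖z‖ ^ 2) := by
  rw [ENNReal.ofReal_pow (norm_nonneg _), ofReal_norm]

/-- The autocorrelation of the indicator function of a set is modulus monotone. -/
theorem modulusMonotone_volume_inter {S : Set V} (hS : MeasurableSet S) (hfin : volume S ≠ ∞) :
    ModulusMonotone fun w => volume {t | t ∈ S ∧ t - w ∈ S} := by
  -- The weight is the autocorrelation of the indicator `h`, hence the Fourier integral of the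
  -- nonnegative function `powerSpectrum h`.
  set h : Lp (α := V) ℂ 2 volume := indicatorConstLp 2 hS hfin 1
  have hfin' (w : V) : volume {t | t ∈ S ∧ t - w ∈ S} ≠ ∞ :=
    ((measure_mono fun t ht => ht.1).trans_lt hfin.lt_top).ne
  have hk (w : V) : 𝓕 (fun x => (powerSpectrum h x : ℂ)) w =
      ((volume {t | t ∈ S ∧ t - w ∈ S}).toReal : ℂ) := by
    rw [← autocorrelation_eq_fourier]
    have hm : MeasurableSet {t | t ∈ S ∧ t - w ∈ S} := hS.inter (measurable_sub_const w hS)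
    have hh := indicatorConstLp_coeFn (p := 2) (hs := hS) (hμs := hfin) (c := (1 : ℂ))
    have : ∫ t, conj (h t) * h (t - w) =
        ∫ t, Set.indicator {t | t ∈ S ∧ t - w ∈ S} (fun _ => (1 : ℂ)) t := by
      refine integral_congr_ae ?_
      filter_upwards [hh, (measurePreserving_sub_right volume w).quasiMeasurePreserving.ae hh]
        with t ht ht'
      rw [ht, ht']
      by_cases h1 : t ∈ S <;> by_cases h2 : t - w ∈ S <;> simp [h1, h2]
    rw [this, integral_indicator_const _ hm]
    simp [Measure.real]
  -- The weight is itself nonnegative, so taking the norm of the integral loses nothing.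
  have hconv (G : Lp (α := V) ℂ 2 volume) (ν : V) :
      ∫⁻ w, ‖(𝓕 G : Lp (α := V) ℂ 2 volume) w‖ₑ ^ 2 *
          volume {t | t ∈ S ∧ t - (w - ν) ∈ S} =
        ENNReal.ofReal ‖∫ w, (powerSpectrum G w : ℂ) *
          𝓕 (fun x => (powerSpectrum h x : ℂ)) (w - ν)‖ := by
    have hi := integrable_mul_fourier_of_integrable (integrable_powerSpectrum_complex G)
      (integrable_powerSpectrum_complex h) ν
    simp only [hk, ← Complex.ofReal_mul] at hi ⊢
    have hnn (w : V) : 0 ≤ powerSpectrum G w *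
        (volume {t | t ∈ S ∧ t - (w - ν) ∈ S}).toReal :=
      mul_nonneg (sq_nonneg _) ENNReal.toReal_nonneg
    rw [integral_complex_ofReal, Complex.norm_real,
      Real.norm_of_nonneg (integral_nonneg hnn),
      ofReal_integral_eq_lintegral_ofReal (by simpa using hi.re) (ae_of_all _ hnn)]
    refine lintegral_congr fun w => ?_
    rw [powerSpectrum, ENNReal.ofReal_mul (sq_nonneg _), ENNReal.ofReal_toReal (hfin' _),
      enorm_sq_eq_ofReal]
  intro F ν
  have h0 := hconv (modulus F) 0
  simp only [sub_zero] at h0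
  rw [hconv, h0]
  exact ENNReal.ofReal_le_ofReal (norm_integral_powerSpectrum_mul_le F h ν)

theorem ENNReal.volume_ofReal_lt (c : ℝ≥0∞) :
    (volume.restrict (Set.Ioi (0 : ℝ))) {s | ENNReal.ofReal s < c} = c := by
  rw [Measure.restrict_apply (measurableSet_lt (by fun_prop) measurable_const)]
  induction c with
  | top => simp
  | coe c =>
    have : {s : ℝ | ENNReal.ofReal s < c} ∩ Set.Ioi 0 = Set.Ioo 0 (c : ℝ) := by
      ext s
      simp only [Set.mem_inter_iff, Set.mem_ofPred_eq, Set.mem_Ioi, Set.mem_Ioo]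
      constructor
      · rintro ⟨h1, h2⟩
        refine ⟨h2, ?_⟩
        rw [← ENNReal.ofReal_coe_nnreal] at h1
        exact (ENNReal.ofReal_lt_ofReal_iff_of_nonneg h2.le).1 h1
      · rintro ⟨h1, h2⟩
        refine ⟨?_, h1⟩
        rw [← ENNReal.ofReal_coe_nnreal]
        exact (ENNReal.ofReal_lt_ofReal_iff_of_nonneg h1.le).2 h2
    rw [this]; simp

/-- Layer-cake mixture of autocorrelations of the superlevel sets of `M`. -/
theorem modulusMonotone_lintegral_min {M : V → ℝ≥0∞} (hM : Measurable M)
    (hfin : volume {x | M x ≠ 0} ≠ ∞) :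
    ModulusMonotone fun w => ∫⁻ x, min (M x) (M (x - w)) := by
  let S (s : ℝ) : Set V := {x | ENNReal.ofReal s < M x}
  have hS (s : ℝ) : MeasurableSet (S s) := measurableSet_lt measurable_const hM
  have hSfin (s : ℝ) : volume (S s) ≠ ∞ :=
    ((measure_mono fun x (hx : _ < M x) => (pos_of_gt hx).ne').trans_lt hfin.lt_top).ne
  have hmeas3 : MeasurableSet {p : (V × ℝ) × V |
      ENNReal.ofReal p.1.2 < M p.2 ∧ ENNReal.ofReal p.1.2 < M (p.2 - p.1.1)} := by
    have h1 : MeasurableSet {p : (V × ℝ) × V | ENNReal.ofReal p.1.2 < M p.2} :=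
      measurableSet_lt (by fun_prop) (by fun_prop)
    have h2 : MeasurableSet {p : (V × ℝ) × V | ENNReal.ofReal p.1.2 < M (p.2 - p.1.1)} :=
      measurableSet_lt (by fun_prop) (by fun_prop)
    exact h1.inter h2
  have hmeas2 : Measurable fun p : V × ℝ => volume {t | t ∈ S p.2 ∧ t - p.1 ∈ S p.2} :=
    measurable_measure_prodMk_left hmeas3
  -- The minimum exceeds `s` exactly when both `x` and `x - w` lie in `S s`; the rest is Tonelli.
  have hk (w : V) : ∫⁻ x, min (M x) (M (x - w)) =
      ∫⁻ s in Set.Ioi (0 : ℝ), volume {t | t ∈ S s ∧ t - w ∈ S s} := by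
    have hm : MeasurableSet {p : V × ℝ |
        ENNReal.ofReal p.2 < M p.1 ∧ ENNReal.ofReal p.2 < M (p.1 - w)} := by
      have h1 : MeasurableSet {p : V × ℝ | ENNReal.ofReal p.2 < M p.1} :=
        measurableSet_lt (by fun_prop) (by fun_prop)
      have h2 : MeasurableSet {p : V × ℝ | ENNReal.ofReal p.2 < M (p.1 - w)} :=
        measurableSet_lt (by fun_prop) (by fun_prop)
      exact h1.inter h2
    have e1 := Measure.prod_apply (μ := volume) (ν := volume.restrict (Set.Ioi (0 : ℝ))) hm
    have e2 := Measure.prod_apply_symm (μ := volume) (ν := volume.restrict (Set.Ioi (0 : ℝ))) hm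
    rw [e1] at e2
    refine Eq.trans (lintegral_congr fun x => ?_) e2
    rw [← ENNReal.volume_ofReal_lt (min (M x) (M (x - w)))]
    congr 1
    ext s
    simp
  intro F ν
  have hF (G : Lp (α := V) ℂ 2 volume) :
      AEMeasurable fun w => ‖(𝓕 G : Lp (α := V) ℂ 2 volume) w‖ₑ ^ 2 :=
    ((Lp.stronglyMeasurable _).measurable.enorm.pow_const _).aemeasurable
  have hswap (G : Lp (α := V) ℂ 2 volume) (ν : V) :
      ∫⁻ w, ‖(𝓕 G : Lp (α := V) ℂ 2 volume) w‖ₑ ^ 2 *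
          ∫⁻ s in Set.Ioi (0 : ℝ), volume {t | t ∈ S s ∧ t - (w - ν) ∈ S s} =
        ∫⁻ s in Set.Ioi (0 : ℝ), ∫⁻ w, ‖(𝓕 G : Lp (α := V) ℂ 2 volume) w‖ₑ ^ 2 *
          volume {t | t ∈ S s ∧ t - (w - ν) ∈ S s} := by
    have hm : Measurable fun p : V × ℝ => volume {t | t ∈ S p.2 ∧ t - (p.1 - ν) ∈ S p.2} :=
      hmeas2.comp (g := fun p : V × ℝ => volume {t | t ∈ S p.2 ∧ t - p.1 ∈ S p.2})
        (f := fun p : V × ℝ => (p.1 - ν, p.2)) (by fun_prop)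
    rw [← lintegral_lintegral_swap]
    · refine lintegral_congr fun w => ?_
      rw [lintegral_const_mul]
      exact hm.comp (measurable_prodMk_left (x := w))
    · exact (((Lp.stronglyMeasurable (𝓕 G : Lp (α := V) ℂ 2 volume)).measurable.comp
        measurable_fst).enorm.pow_const 2 |>.mul hm).aemeasurable
  have h0 := hswap (modulus F) 0
  simp only [sub_zero] at h0
  simp only [hk]
  rw [hswap, h0]
  exact lintegral_mono fun s => modulusMonotone_volume_inter (hS s) (hSfin s) F ν

theorem ModulusMonotone.of_const_mul {k : V → ℝ≥0∞} {c : ℝ≥0∞} (hc : c ≠ 0) (hc' : c ≠ ∞)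
    (h : ModulusMonotone fun w => c * k w) : ModulusMonotone k := by
  intro F ν
  have := h F ν
  simp only [mul_left_comm _ c] at this
  rwa [lintegral_const_mul' _ _ hc', lintegral_const_mul' _ _ hc',
    ENNReal.mul_le_mul_iff_right hc hc'] at this

end ModulusMonotone

/-! ### Line integrals of radial profiles and their inversion -/

section RadialSlice

open Set

/-- Integration of the radial profile `N` along a line at distance `ρ` from the origin. -/
noncomputable def radialSlice (N : ℝ → ℝ≥0∞) (ρ : ℝ) : ℝ≥0∞ := ∫⁻ z : ℝ, N √(ρ ^ 2 + z ^ 2)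

theorem measurable_radialSlice {N : ℝ → ℝ≥0∞} (hN : Measurable N) :
    Measurable (radialSlice N) :=
  Measurable.lintegral_prod_right' (f := fun p : ℝ × ℝ => N √(p.1 ^ 2 + p.2 ^ 2))
    (hN.comp (by fun_prop))

theorem measurable_radialSlice_iterate {N : ℝ → ℝ≥0∞} (hN : Measurable N) (n : ℕ) :
    Measurable (radialSlice^[n] N) := by
  induction n with
  | zero => exact hN
  | succ n ih => rw [Function.iterate_succ_apply']; exact measurable_radialSlice ih

theorem sqrt_add_sq_pos {ρ : ℝ} (hρ : 0 < ρ) (z : ℝ) : 0 < √(ρ ^ 2 + z ^ 2) := by positivity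

theorem le_sqrt_add_sq {ρ : ℝ} (z : ℝ) : ρ ≤ √(ρ ^ 2 + z ^ 2) :=
  Real.le_sqrt_of_sq_le (by nlinarith [sq_nonneg z])

theorem radialSlice_congr {N N' : ℝ → ℝ≥0∞} (h : ∀ ρ, 0 < ρ → N ρ = N' ρ) {ρ : ℝ} (hρ : 0 < ρ) :
    radialSlice N ρ = radialSlice N' ρ :=
  lintegral_congr fun z => h _ (sqrt_add_sq_pos hρ z)

theorem radialSlice_iterate_add {N N' : ℝ → ℝ≥0∞} (hN : Measurable N) (n : ℕ) :
    radialSlice^[n] (N + N') = radialSlice^[n] N + radialSlice^[n] N' := by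
  induction n with
  | zero => rfl
  | succ n ih =>
    ext ρ
    rw [Function.iterate_succ_apply', Function.iterate_succ_apply', Function.iterate_succ_apply',
      ih]
    exact lintegral_add_left ((measurable_radialSlice_iterate hN n).comp (by fun_prop)) _

theorem antitoneOn_radialSlice {N : ℝ → ℝ≥0∞} (hN : AntitoneOn N (Ioi 0)) :
    AntitoneOn (radialSlice N) (Ioi 0) := fun ρ hρ ρ' hρ' h =>
  lintegral_mono fun z => hN (sqrt_add_sq_pos hρ z) (sqrt_add_sq_pos hρ' z)
    (Real.sqrt_le_sqrt (by have := mem_Ioi.1 hρ; gcongr))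

/-- Two slices integrate over a plane at distance `ρ`, in polar coordinates. The result is
elementary to invert: up to the factor `-1/(2πρ)`, the profile is the derivative of its double
slice. -/
theorem radialSlice_radialSlice {N : ℝ → ℝ≥0∞} (hN : Measurable N) (ρ : ℝ) :
    radialSlice (radialSlice N) ρ =
      ∫⁻ r in Ioi (0 : ℝ), ENNReal.ofReal (2 * Real.pi * r) * N √(ρ ^ 2 + r ^ 2) := by
  have h1 : radialSlice (radialSlice N) ρ =
      ∫⁻ p : ℝ × ℝ, N √(ρ ^ 2 + (p.1 ^ 2 + p.2 ^ 2)) := by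
    rw [Measure.volume_eq_prod, lintegral_prod _ (by fun_prop)]
    refine lintegral_congr fun z => lintegral_congr fun y => ?_
    rw [Real.sq_sqrt (by positivity), add_assoc]
  rw [h1, ← lintegral_comp_polarCoord_symm, polarCoord_target, Measure.volume_eq_prod,
    ← Measure.prod_restrict]
  have h2 (p : ℝ × ℝ) : (polarCoord.symm p).1 ^ 2 + (polarCoord.symm p).2 ^ 2 = p.1 ^ 2 := by
    rw [polarCoord_symm_apply]
    linear_combination p.1 ^ 2 * Real.sin_sq_add_cos_sq p.2
  simp only [h2, smul_eq_mul]
  rw [lintegral_prod _ (by fun_prop)]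
  refine lintegral_congr fun r => ?_
  simp only [lintegral_const, Measure.restrict_apply_univ, Real.volume_Ioo]
  rw [mul_right_comm, mul_comm, ← ENNReal.ofReal_mul' (by linarith [Real.pi_pos]), mul_comm]
  congr 2
  ring

/-- The profile `κ ρ⁻ᶜ (a - ρ)₊ᵇ`. -/
noncomputable def powerProfile (a κ c b ρ : ℝ) : ℝ≥0∞ :=
  ENNReal.ofReal (κ * ρ ^ (-c) * max 0 (a - ρ) ^ b)

theorem measurable_powerProfile (a κ c b : ℝ) : Measurable (powerProfile a κ c b) := by
  unfold powerProfile
  fun_prop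

theorem powerProfile_eq_zero {a κ c b ρ : ℝ} (hb : 0 < b) (h : a ≤ ρ) :
    powerProfile a κ c b ρ = 0 := by
  rw [powerProfile, max_eq_left (by linarith), Real.zero_rpow hb.ne', mul_zero, ENNReal.ofReal_zero]

theorem antitoneOn_powerProfile {a κ c b : ℝ} (hκ : 0 ≤ κ) (hc : 0 ≤ c) (hb : 0 ≤ b) :
    AntitoneOn (powerProfile a κ c b) (Ioi 0) := by
  intro ρ hρ ρ' hρ' h
  have hρ0 := mem_Ioi.1 hρ
  refine ENNReal.ofReal_le_ofReal ?_
  have h1 : ρ' ^ (-c) ≤ ρ ^ (-c) := Real.rpow_le_rpow_of_nonpos hρ0 h (by linarith)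
  have h2 : max 0 (a - ρ') ^ b ≤ max 0 (a - ρ) ^ b :=
    Real.rpow_le_rpow (le_max_left _ _) (max_le_max le_rfl (by linarith)) hb
  have h3 : 0 ≤ ρ' ^ (-c) := Real.rpow_nonneg (le_trans hρ0.le h) _
  exact mul_le_mul (mul_le_mul_of_nonneg_left h1 hκ) h2 (Real.rpow_nonneg (le_max_left _ _) _)
    (mul_nonneg hκ (h3.trans h1))

/-- Nonnegativity of the derivative and continuity of `f` on the closed interval already imply
integrability. -/
theorem lintegral_Ioc_ofReal_deriv {f f' : ℝ → ℝ} {x y : ℝ} (hxy : x ≤ y)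
    (hc : ContinuousOn f (Icc x y)) (hd : ∀ t ∈ Ioo x y, HasDerivAt f (f' t) t)
    (hn : ∀ t ∈ Ioo x y, 0 ≤ f' t) :
    ∫⁻ t in Ioc x y, ENNReal.ofReal (f' t) = ENNReal.ofReal (f y - f x) := by
  have hi : IntervalIntegrable f' volume x y :=
    intervalIntegral.intervalIntegrable_deriv_of_nonneg (by rwa [uIcc_of_le hxy])
      (by rwa [min_eq_left hxy, max_eq_right hxy]) (by rwa [min_eq_left hxy, max_eq_right hxy])
  rw [← intervalIntegral.integral_eq_sub_of_hasDerivAt_of_le hxy hc hd hi,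
    intervalIntegral.integral_of_le hxy, ofReal_integral_eq_lintegral_ofReal
      ((intervalIntegrable_iff_integrableOn_Ioc_of_le hxy).1 hi)]
  rw [← Measure.restrict_congr_set Ioo_ae_eq_Ioc]
  exact (ae_restrict_iff' measurableSet_Ioo).2 (ae_of_all _ hn)

theorem lintegral_Ioi_eq_Ioc {f : ℝ → ℝ≥0∞} {x y : ℝ} (h : ∀ t, y < t → f t = 0) :
    ∫⁻ t in Ioi x, f t = ∫⁻ t in Ioc x y, f t := by
  rw [← lintegral_indicator measurableSet_Ioi, ← lintegral_indicator measurableSet_Ioc]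
  refine lintegral_congr fun t => ?_
  rcases le_or_gt t y with ht | ht
  · simp [indicator, ht]
  · simp [indicator, h t ht]

/-- `powerProfile` is obtained by two radial slices from profiles of the same form. -/
theorem radialSlice_radialSlice_powerProfile {a κ c b ρ : ℝ} (hκ : 0 ≤ κ) (hc : 0 ≤ c)
    (hb : 1 < b) (hρ : 0 < ρ) :
    radialSlice (radialSlice (powerProfile a (κ * c / (2 * Real.pi)) (c + 2) b +
      powerProfile a (κ * b / (2 * Real.pi)) (c + 1) (b - 1))) ρ = powerProfile a κ c b ρ := by
  rw [radialSlice_radialSlice ((measurable_powerProfile _ _ _ _).add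
    (measurable_powerProfile _ _ _ _))]
  have hzero {r : ℝ} (hr : a ≤ √(ρ ^ 2 + r ^ 2)) :
      ENNReal.ofReal (2 * Real.pi * r) * (powerProfile a (κ * c / (2 * Real.pi)) (c + 2) b +
        powerProfile a (κ * b / (2 * Real.pi)) (c + 1) (b - 1)) √(ρ ^ 2 + r ^ 2) = 0 := by
    rw [Pi.add_apply, powerProfile_eq_zero (by linarith) hr,
      powerProfile_eq_zero (by linarith) hr, add_zero, mul_zero]
  rcases le_or_gt a ρ with ha | ha
  · rw [powerProfile_eq_zero (by linarith) ha]
    exact (lintegral_congr fun r => hzero (ha.trans (le_sqrt_add_sq _))).trans lintegral_zero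
  -- The radius in the plane at which the distance to the origin reaches `a` and the profile
  -- vanishes.
  set R := √(a ^ 2 - ρ ^ 2) with hR
  have hR2 : R ^ 2 = a ^ 2 - ρ ^ 2 := Real.sq_sqrt (by nlinarith)
  have hR0 : 0 ≤ R := Real.sqrt_nonneg _
  have hvR : √(ρ ^ 2 + R ^ 2) = a := by
    rw [hR2, add_sub_cancel, Real.sqrt_sq (hρ.le.trans ha.le)]
  rw [lintegral_Ioi_eq_Ioc (y := R)]
  swap
  · intro t ht
    refine hzero ?_
    rw [← hvR]
    exact Real.sqrt_le_sqrt (by gcongr)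
  have hlt {t : ℝ} (ht : t ∈ Ioo 0 R) : √(ρ ^ 2 + t ^ 2) < a := by
    rw [← hvR]
    have := ht.1
    exact Real.sqrt_lt_sqrt (by positivity) (by have := ht.2; gcongr)
  -- Minus the target profile at distance `√(ρ² + r²)`. It increases in `r` from minus the claimed
  -- value to `0`, and its derivative is the integrand.
  set f : ℝ → ℝ := fun r => -(κ * √(ρ ^ 2 + r ^ 2) ^ (-c) * (a - √(ρ ^ 2 + r ^ 2)) ^ b) with hf
  set f' : ℝ → ℝ := fun r => 2 * Real.pi * r *
    (κ * c / (2 * Real.pi) * √(ρ ^ 2 + r ^ 2) ^ (-(c + 2)) * (a - √(ρ ^ 2 + r ^ 2)) ^ b +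
      κ * b / (2 * Real.pi) * √(ρ ^ 2 + r ^ 2) ^ (-(c + 1)) *
        (a - √(ρ ^ 2 + r ^ 2)) ^ (b - 1)) with hf'
  have hcongr : ∫⁻ r in Ioc 0 R, ENNReal.ofReal (2 * Real.pi * r) *
      (powerProfile a (κ * c / (2 * Real.pi)) (c + 2) b +
        powerProfile a (κ * b / (2 * Real.pi)) (c + 1) (b - 1)) √(ρ ^ 2 + r ^ 2) =
      ∫⁻ r in Ioc 0 R, ENNReal.ofReal (f' r) := by
    rw [← Measure.restrict_congr_set Ioo_ae_eq_Ioc]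
    refine setLIntegral_congr_fun measurableSet_Ioo fun r hr => ?_
    have h1 := hlt hr
    have h2 := sqrt_add_sq_pos hρ r
    have h0 := hr.1
    have h3 : 0 < a - √(ρ ^ 2 + r ^ 2) := by linarith
    simp only [Pi.add_apply, powerProfile, hf', max_eq_right h3.le]
    rw [← ENNReal.ofReal_add (by positivity) (by positivity), ← ENNReal.ofReal_mul (by positivity)]
  rw [hcongr, lintegral_Ioc_ofReal_deriv (f := f) hR0]
  · have hf0 : f 0 = -(κ * ρ ^ (-c) * (a - ρ) ^ b) := by
      simp [hf, Real.sqrt_sq hρ.le]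
    have hfR : f R = 0 := by
      simp only [hf, hvR]
      rw [sub_self, Real.zero_rpow (by linarith)]; simp
    rw [hf0, hfR, powerProfile, max_eq_right (by linarith)]
    simp
  · refine ContinuousOn.neg (ContinuousOn.mul (ContinuousOn.mul continuousOn_const ?_) ?_)
    · exact ContinuousOn.rpow_const (by fun_prop) fun t _ => Or.inl (sqrt_add_sq_pos hρ t).ne'
    · exact ContinuousOn.rpow_const (by fun_prop) fun t _ => Or.inr (by linarith)
  · intro t ht
    have hv := sqrt_add_sq_pos hρ t
    have hd : HasDerivAt (fun r => √(ρ ^ 2 + r ^ 2)) (t / √(ρ ^ 2 + t ^ 2)) t := by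
      have := ((hasDerivAt_pow 2 t).const_add (ρ ^ 2)).sqrt (by positivity)
      convert this using 1
      field_simp
      push_cast
      ring
    have h1 := hd.rpow_const (p := -c) (Or.inl hv.ne')
    have h2 := (hd.const_sub a).rpow_const (p := b) (Or.inr hb.le)
    refine ((h1.const_mul κ).mul h2).neg.congr_deriv ?_
    simp only [hf']
    have e1 : √(ρ ^ 2 + t ^ 2) ^ (-(c + 2)) = √(ρ ^ 2 + t ^ 2) ^ (-c - 1) / √(ρ ^ 2 + t ^ 2) := by
      rw [← Real.rpow_sub_one hv.ne']; congr 1; ring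
    have e2 : √(ρ ^ 2 + t ^ 2) ^ (-(c + 1)) = √(ρ ^ 2 + t ^ 2) ^ (-c) / √(ρ ^ 2 + t ^ 2) := by
      rw [← Real.rpow_sub_one hv.ne']; congr 1; ring
    rw [e1, e2]
    have hpi := Real.pi_pos
    field_simp
    ring
  · intro r hr
    have h1 := hlt hr
    have h2 := sqrt_add_sq_pos hρ r
    have h0 := hr.1
    have h3 : 0 < a - √(ρ ^ 2 + r ^ 2) := by linarith
    simp only [hf']
    positivity

/-- Each inversion of a double slice produces two profiles, one with `b` lowered by one, hence the
condition `j < b`. The exponent `c` grows along the way, so the induction must allow profiles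
singular at `0`, and monotonicity is asserted only on the positive axis. -/
theorem exists_radialSlice_iterate_even (a : ℝ) (j : ℕ) {κ c b : ℝ} (hκ : 0 ≤ κ) (hc : 0 ≤ c)
    (hb : (j : ℝ) < b) :
    ∃ N : ℝ → ℝ≥0∞, Measurable N ∧ AntitoneOn N (Ioi 0) ∧ (∀ ρ, a ≤ ρ → N ρ = 0) ∧
      ∀ ρ, 0 < ρ → radialSlice^[2 * j] N ρ = powerProfile a κ c b ρ := by
  induction j generalizing κ c b with
  | zero =>
    have hb0 : 0 < b := by simpa using hb
    exact ⟨_, measurable_powerProfile a κ c b, antitoneOn_powerProfile hκ hc hb0.le,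
      fun ρ h => powerProfile_eq_zero hb0 h, fun ρ _ => rfl⟩
  | succ j ih =>
    push_cast at hb
    have hj : (0 : ℝ) ≤ j := Nat.cast_nonneg j
    have hpi := Real.pi_pos
    have hb0 : 0 < b := by linarith
    obtain ⟨N₁, m₁, a₁, z₁, h₁⟩ := ih (κ := κ * c / (2 * Real.pi)) (c := c + 2) (b := b)
      (by positivity) (by positivity) (by linarith)
    obtain ⟨N₂, m₂, a₂, z₂, h₂⟩ := ih (κ := κ * b / (2 * Real.pi)) (c := c + 1) (b := b - 1)
      (by positivity) (by positivity) (by linarith)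
    refine ⟨N₁ + N₂, m₁.add m₂, fun x hx y hy h => add_le_add (a₁ hx hy h) (a₂ hx hy h),
      fun ρ hρ => by simp [z₁ ρ hρ, z₂ ρ hρ], fun ρ hρ => ?_⟩
    rw [← radialSlice_radialSlice_powerProfile hκ hc (by linarith) hρ, Nat.mul_succ,
      Function.iterate_succ_apply', Function.iterate_succ_apply', radialSlice_iterate_add m₁]
    refine radialSlice_congr (fun ρ hρ => radialSlice_congr (fun ρ hρ => ?_) hρ) hρ
    rw [Pi.add_apply, Pi.add_apply, h₁ ρ hρ, h₂ ρ hρ]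

/-- For odd `n` one slice too many is inverted and then restored, hence the rounding up of `n / 2`.
-/
theorem exists_radialSlice_iterate (a : ℝ) (n : ℕ) {b : ℝ} (hb : (((n + 1) / 2 : ℕ) : ℝ) < b) :
    ∃ N : ℝ → ℝ≥0∞, Measurable N ∧ AntitoneOn N (Ioi 0) ∧ (∀ ρ, a ≤ ρ → N ρ = 0) ∧
      ∀ ρ, 0 < ρ → radialSlice^[n] N ρ = powerProfile a 1 0 b ρ := by
  obtain ⟨N, hm, ha, hz, h⟩ := exists_radialSlice_iterate_even a ((n + 1) / 2) zero_le_one le_rfl hb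
  rcases Nat.even_or_odd' n with ⟨j, rfl | rfl⟩
  · have : 2 * ((2 * j + 1) / 2) = 2 * j := by omega
    rw [this] at h
    exact ⟨N, hm, ha, hz, h⟩
  · have : 2 * ((2 * j + 1 + 1) / 2) = 2 * j + 1 + 1 := by omega
    rw [this] at h
    refine ⟨radialSlice N, measurable_radialSlice hm, antitoneOn_radialSlice ha, fun ρ hρ => ?_, h⟩
    simp [radialSlice, hz _ (hρ.trans (le_sqrt_add_sq _))]

theorem lintegral_Ioi_powerProfile {a b ρ : ℝ} (hb : 0 < b) :
    ∫⁻ v in Ioi ρ, powerProfile a 1 0 b v = ENNReal.ofReal (max 0 (a - ρ) ^ (b + 1) / (b + 1)) := by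
  rcases le_or_gt a ρ with ha | ha
  · rw [max_eq_left (by linarith), Real.zero_rpow (by linarith), zero_div, ENNReal.ofReal_zero]
    refine (setLIntegral_congr_fun measurableSet_Ioi fun v hv => ?_).trans lintegral_zero
    exact powerProfile_eq_zero hb (ha.trans (le_of_lt hv))
  rw [lintegral_Ioi_eq_Ioc (y := a) fun t ht => powerProfile_eq_zero hb ht.le]
  have hcongr : ∫⁻ v in Ioc ρ a, powerProfile a 1 0 b v =
      ∫⁻ v in Ioc ρ a, ENNReal.ofReal ((a - v) ^ b) := by
    refine setLIntegral_congr_fun measurableSet_Ioc fun v hv => ?_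
    simp [powerProfile, hv.2]
  rw [hcongr, lintegral_Ioc_ofReal_deriv (f := fun v => -((a - v) ^ (b + 1) / (b + 1))) ha.le,
    max_eq_right (by linarith)]
  · simp [Real.zero_rpow (show b + 1 ≠ 0 by linarith)]
  · refine ContinuousOn.neg (ContinuousOn.div_const ?_ _)
    exact ContinuousOn.rpow_const (by fun_prop) fun t _ => Or.inr (by linarith)
  · intro t ht
    have h2 := (((hasDerivAt_id t).const_sub a).rpow_const (p := b + 1)
      (Or.inr (by linarith))).div_const (b + 1) |>.neg
    refine h2.congr_deriv ?_
    simp only [id, add_sub_cancel_right]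
    field_simp
  · intro t ht
    exact Real.rpow_nonneg (by linarith [ht.2]) _

end RadialSlice

/-! ### The weight `|r̂_l|²` as a mixture of autocorrelations -/

section RadialWeight

open Set

theorem lintegral_pi_succ {n : ℕ} {g : (Fin (n + 1) → ℝ) → ℝ≥0∞} (hg : Measurable g) :
    ∫⁻ y, g y = ∫⁻ v : ℝ, ∫⁻ z : Fin n → ℝ, g (Fin.cons v z) := by
  rw [← (volume_preserving_piFinSuccAbove (fun _ : Fin (n + 1) => ℝ) 0).symm.lintegral_comp hg,
    Measure.volume_eq_prod, lintegral_prod]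
  · refine lintegral_congr fun v => lintegral_congr fun z => ?_
    simp [MeasurableEquiv.piFinSuccAbove_symm_apply, Fin.insertNthEquiv]
  · exact (hg.comp (MeasurableEquiv.measurable _)).aemeasurable

theorem lintegral_pi_radial {N : ℝ → ℝ≥0∞} (hN : Measurable N) (n : ℕ) {ρ : ℝ} (hρ : 0 < ρ) :
    ∫⁻ y : Fin n → ℝ, N √(ρ ^ 2 + ∑ i, y i ^ 2) = radialSlice^[n] N ρ := by
  induction n generalizing ρ with
  | zero => simp [Real.sqrt_sq hρ.le, volume_pi]
  | succ n ih =>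
    rw [lintegral_pi_succ (by fun_prop), Function.iterate_succ_apply', radialSlice]
    refine lintegral_congr fun v => ?_
    rw [← ih (sqrt_add_sq_pos hρ v)]
    refine lintegral_congr fun z => ?_
    rw [Real.sq_sqrt (by positivity), Fin.sum_univ_succ]
    simp [add_assoc]

theorem setLIntegral_halfSpace_radial {N : ℝ → ℝ≥0∞} (hN : Measurable N) (n : ℕ) {r : ℝ}
    (hr : 0 ≤ r) :
    ∫⁻ x in {x : Rd (n + 1) | r < x 0}, N ‖x‖ = ∫⁻ v in Ioi r, radialSlice^[n] N v := by
  have hm : MeasurableSet {x : Rd (n + 1) | r < x 0} :=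
    measurableSet_lt measurable_const (by fun_prop)
  have hN' : Measurable fun x : Rd (n + 1) => N ‖x‖ := hN.comp measurable_norm
  rw [← lintegral_indicator hm, ← lintegral_indicator measurableSet_Ioi,
    ← (PiLp.volume_preserving_toLp (Fin (n + 1))).lintegral_comp
      (hN'.indicator hm), lintegral_pi_succ]
  · refine lintegral_congr fun v => ?_
    by_cases hv : r < v
    · have h (z : Fin n → ℝ) : WithLp.toLp 2 (Fin.cons v z : Fin (n + 1) → ℝ) ∈
          {x : Rd (n + 1) | r < x 0} := hv
      rw [indicator_of_mem (show v ∈ Ioi r from hv), ← lintegral_pi_radial hN n (hr.trans_lt hv)]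
      refine lintegral_congr fun z => ?_
      rw [indicator_of_mem (h z), EuclideanSpace.norm_eq, Fin.sum_univ_succ]
      simp
    · have h (z : Fin n → ℝ) : WithLp.toLp 2 (Fin.cons v z : Fin (n + 1) → ℝ) ∉
          {x : Rd (n + 1) | r < x 0} := hv
      rw [indicator_of_notMem (show v ∉ Ioi r from hv)]
      simp [indicator_of_notMem (h _)]
  · exact (hN'.indicator hm).comp (by fun_prop)

/-- The hyperplane `x 0 = r / 2` bisects the segment between the two centres. On each side the
minimum is the value for the farther centre, and the point reflection `x ↦ e - x` exchanges the two
sides. -/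
theorem lintegral_min_radial_single {N : ℝ → ℝ≥0∞} (hN : Measurable N)
    (ha : AntitoneOn N (Ioi 0)) (n : ℕ) {r : ℝ} (hr : 0 ≤ r) :
    ∫⁻ x : Rd (n + 1), min (N ‖x‖) (N ‖x - EuclideanSpace.single 0 r‖) =
      2 * ∫⁻ v in Ioi (r / 2), radialSlice^[n] N v := by
  set e : Rd (n + 1) := EuclideanSpace.single 0 r with he
  have he0 : e 0 = r := by simp [he]
  have hm : MeasurableSet {x : Rd (n + 1) | r / 2 < x 0} :=
    measurableSet_lt measurable_const (by fun_prop)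
  have hnorm (x : Rd (n + 1)) : ‖x - e‖ ^ 2 = ‖x‖ ^ 2 - 2 * r * (x 0 - r / 2) := by
    rw [norm_sub_sq_real, real_inner_comm, he, EuclideanSpace.inner_single_left]
    simp
    ring
  -- Both centres are discarded because `N` is monotone only at positive radii.
  have hne : ∀ᵐ x : Rd (n + 1), x ≠ 0 := by simp [ae_iff, measure_singleton]
  have hne' : ∀ᵐ x : Rd (n + 1), x ≠ e := by simp [ae_iff, measure_singleton]
  have h1 : ∫⁻ x in {x : Rd (n + 1) | r / 2 < x 0}, min (N ‖x‖) (N ‖x - e‖) =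
      ∫⁻ x in {x : Rd (n + 1) | r / 2 < x 0}, N ‖x‖ := by
    refine lintegral_congr_ae ((ae_restrict_iff' hm).2 ?_)
    filter_upwards [hne, hne'] with x hx hx' hxr
    refine min_eq_left (ha (norm_pos_iff.2 (sub_ne_zero.2 hx')) (norm_pos_iff.2 hx) ?_)
    have := hnorm x
    have h3 : r / 2 < x 0 := hxr
    exact abs_le_of_sq_le_sq' (by nlinarith) (norm_nonneg _) |>.2
  have hc : {x : Rd (n + 1) | r / 2 < x 0}ᶜ = {x : Rd (n + 1) | x 0 ≤ r / 2} := by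
    ext x; simp
  have h2 : ∫⁻ x in {x : Rd (n + 1) | r / 2 < x 0}ᶜ, min (N ‖x‖) (N ‖x - e‖) =
      ∫⁻ x in {x : Rd (n + 1) | r / 2 ≤ x 0}, N ‖x‖ := by
    have hp : MeasurePreserving (fun x : Rd (n + 1) => e - x) volume volume :=
      Measure.measurePreserving_sub_left volume e
    rw [hc]
    calc _ = ∫⁻ x in {x : Rd (n + 1) | x 0 ≤ r / 2}, N ‖x - e‖ := by
          refine lintegral_congr_ae ((ae_restrict_iff'
            (measurableSet_le (by fun_prop) measurable_const)).2 ?_)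
          filter_upwards [hne, hne'] with x hx hx' hxr
          refine min_eq_right (ha (norm_pos_iff.2 hx) (norm_pos_iff.2 (sub_ne_zero.2 hx')) ?_)
          have := hnorm x
          have h3 : x 0 ≤ r / 2 := hxr
          exact abs_le_of_sq_le_sq' (by nlinarith) (norm_nonneg _) |>.2
      _ = ∫⁻ x in (fun x : Rd (n + 1) => e - x) ⁻¹' {x | r / 2 ≤ x 0}, N ‖e - x‖ := by
          have : (fun x : Rd (n + 1) => e - x) ⁻¹' {x | r / 2 ≤ x 0} = {x | x 0 ≤ r / 2} := by
            ext x
            simp only [mem_preimage, mem_ofPred_eq, PiLp.sub_apply, he0]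
            constructor <;> intro h <;> linarith
          simp only [this, norm_sub_rev]
      _ = _ := hp.setLIntegral_comp_preimage (measurableSet_le measurable_const (by fun_prop))
          (hN.comp measurable_norm)
  have h3 : ({x : Rd (n + 1) | r / 2 ≤ x 0} : Set (Rd (n + 1))) =ᵐ[volume]
      {x : Rd (n + 1) | r / 2 < x 0} := by
    have hae : ∀ᵐ x : Rd (n + 1), x 0 ≠ r / 2 :=
      (PiLp.volume_preserving_ofLp (Fin (n + 1))).quasiMeasurePreserving.ae
        (Measure.ae_eval_ne (μ := fun _ => volume) 0 (r / 2))
    filter_upwards [hae] with x hx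
    exact propext ⟨fun h => lt_of_le_of_ne h hx.symm, fun h => le_of_lt h⟩
  rw [← lintegral_add_compl _ hm, h1, h2, Measure.restrict_congr_set h3,
    setLIntegral_halfSpace_radial hN n (by linarith), two_mul]

theorem lintegral_min_radial {N : ℝ → ℝ≥0∞} (hN : Measurable N)
    (ha : AntitoneOn N (Ioi 0)) (n : ℕ) (w : Rd (n + 1)) :
    ∫⁻ x : Rd (n + 1), min (N ‖x‖) (N ‖x - w‖) =
      2 * ∫⁻ v in Ioi (‖w‖ / 2), radialSlice^[n] N v := by
  rw [← lintegral_min_radial_single hN ha n (norm_nonneg w)]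
  set e : Rd (n + 1) := EuclideanSpace.single 0 ‖w‖ with he
  have hn : ‖w‖ = ‖e‖ := by simp [he]
  -- The reflection carrying `w` to the first coordinate axis.
  set R := Submodule.reflection (Submodule.span ℝ {w - e})ᗮ
  have hR : R w = e := Submodule.reflection_sub hn
  rw [← R.measurePreserving.lintegral_comp (f := fun x => min (N ‖x‖) (N ‖x - e‖))
    (by fun_prop)]
  refine lintegral_congr fun x => ?_
  rw [← hR, ← map_sub, R.norm_map, R.norm_map]

/-- The weight `|r̂_l(ω / R)|²` is modulus monotone. -/
theorem modulusMonotone_rHat_sq {d : ℕ} (hd : 1 ≤ d) {l : ℝ} (hl : ((d / 2 : ℕ) : ℝ) + 1 < l)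
    {R : ℝ} (hR : 0 < R) :
    ModulusMonotone fun w : Rd d => ENNReal.ofReal (|rHat l (R⁻¹ • w)| ^ 2) := by
  obtain ⟨n, rfl⟩ : ∃ n, d = n + 1 := ⟨d - 1, by omega⟩
  have hn : (0 : ℝ) ≤ (((n + 1) / 2 : ℕ) : ℝ) := Nat.cast_nonneg _
  -- The tail integral of `(R/2 - v)₊^(2l-1)` from `‖w‖/2` is `(R/2 - ‖w‖/2)₊^(2l) / (2l)`, a
  -- multiple of the desired weight.
  obtain ⟨N, hm, ha, hz, h⟩ := exists_radialSlice_iterate (R / 2) n (b := 2 * l - 1) (by linarith)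
  have hl0 : 0 < l := by linarith
  have hgood := modulusMonotone_lintegral_min (M := fun x : Rd (n + 1) => N ‖x‖)
    (hm.comp measurable_norm) (by
      refine ((measure_mono fun x hx => ?_).trans_lt
        (measure_ball_lt_top (x := (0 : Rd (n + 1))) (r := R / 2))).ne
      rw [mem_ball_zero_iff]
      by_contra hcon
      exact hx (hz _ (not_lt.1 hcon)))
  refine ModulusMonotone.of_const_mul (c := 2 * ENNReal.ofReal ((R / 2) ^ (2 * l) / (2 * l)))
    ?_ ?_ ?_
  · have : 0 < (R / 2) ^ (2 * l) / (2 * l) := by positivity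
    simpa using this
  · exact ENNReal.mul_ne_top (by norm_num) ENNReal.ofReal_ne_top
  convert hgood using 2 with w
  rw [lintegral_min_radial hm ha, setLIntegral_congr_fun measurableSet_Ioi fun v hv =>
    h v ((div_nonneg (norm_nonneg w) zero_le_two).trans_lt hv),
    lintegral_Ioi_powerProfile (by linarith), mul_assoc, ← ENNReal.ofReal_mul (by positivity)]
  congr 2
  have e1 : max 0 (R / 2 - ‖w‖ / 2) = R / 2 * max 0 (1 - ‖R⁻¹ • w‖) := by
    rw [norm_smul, norm_inv, Real.norm_of_nonneg hR.le, mul_max_of_nonneg _ _ (by positivity)]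
    congr 1
    · ring
    · field_simp
  have hmax : 0 ≤ max 0 (1 - ‖R⁻¹ • w‖) := le_max_left _ _
  rw [e1, rHat, sq_abs, ← Real.rpow_natCast, ← Real.rpow_mul hmax, sub_add_cancel,
    Real.mul_rpow (by positivity) hmax]
  push_cast
  rw [mul_comm l 2]
  ring

end RadialWeight

/-! ### The frequency shift for spectra in an orthant -/

section OrthantShift

theorem decayExponent_of_two_le {d : ℕ} (hd : 2 ≤ d) :
    decayExponent d = Real.log (1 + 1 / (2 * d - 1)) / (2 * Real.log 2) := by
  have hd' : (2 : ℝ) ≤ d := by exact_mod_cast hd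
  rw [decayExponent, if_neg (by omega), Real.logb, Real.log_sqrt]
  · have : (d : ℝ) / (d - 1 / 2) = 1 + 1 / (2 * d - 1) := by
      have h1 : (d : ℝ) - 1 / 2 ≠ 0 := by linarith
      have h2 : (2 : ℝ) * d - 1 ≠ 0 := by linarith
      rw [div_eq_iff h1, add_mul, div_mul_eq_mul_div, eq_comm, ← eq_sub_iff_add_eq', div_eq_iff h2]
      ring
    rw [this, div_div]
  · apply div_nonneg <;> linarith

theorem decayExponent_pos {d : ℕ} (hd : 1 ≤ d) : 0 < decayExponent d := by
  rcases hd.eq_or_lt with rfl | hd2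
  · simp [decayExponent]
  · have hd' : (2 : ℝ) ≤ d := by exact_mod_cast hd2
    rw [decayExponent_of_two_le hd2]
    have h1 : (0 : ℝ) < 1 / (2 * d - 1) := by apply one_div_pos.2; linarith
    have := Real.log_pos (show (1 : ℝ) < 1 + 1 / (2 * d - 1) by linarith)
    have := Real.log_pos one_lt_two
    positivity

/-- By `log (1 + x) ≤ x` it suffices that `d ≤ (2d - 1) log 2`, which holds from `d = 2` on because
`3 log 2 > 2`. -/
theorem two_mul_decayExponent_le {d : ℕ} (hd : 2 ≤ d) : 2 * decayExponent d ≤ 1 / d := by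
  have hd' : (2 : ℝ) ≤ d := by exact_mod_cast hd
  rw [decayExponent_of_two_le hd]
  have h0 : (0 : ℝ) < 2 * d - 1 := by linarith
  have h1 : Real.log (1 + 1 / (2 * d - 1)) ≤ 1 / (2 * (d : ℝ) - 1) := by
    have := Real.log_le_sub_one_of_pos (show (0 : ℝ) < 1 + 1 / (2 * d - 1) by positivity)
    linarith
  have h2 : (0.69 : ℝ) < Real.log 2 := by linarith [Real.log_two_gt_d9]
  have h3 : 2 * (Real.log (1 + 1 / (2 * (d : ℝ) - 1)) / (2 * Real.log 2)) =
      Real.log (1 + 1 / (2 * d - 1)) / Real.log 2 := by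
    field_simp
  rw [h3, div_le_div_iff₀ (by linarith) (by linarith)]
  calc _ ≤ 1 / (2 * (d : ℝ) - 1) * d := by gcongr
    _ ≤ 1 * Real.log 2 := by
      rw [div_mul_eq_mul_div, div_le_iff₀ h0]
      nlinarith

/-- Bernoulli's inequality for exponents in `[0, 1]`, together with `N ^ p ≤ N`. -/
theorem add_one_rpow_sub_rpow_le {N : ℕ} (hN : 1 ≤ N) {p : ℝ} (h0 : 0 ≤ p) (h1 : p ≤ 1) :
    ((N : ℝ) + 1) ^ p - (N : ℝ) ^ p ≤ p := by
  have hN' : (1 : ℝ) ≤ N := by exact_mod_cast hN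
  have hb := rpow_one_add_le_one_add_mul_self (s := 1 / (N : ℝ))
    (by have : (0 : ℝ) ≤ 1 / N := by positivity
        linarith) h0 h1
  have e : ((N : ℝ) + 1) = N * (1 + 1 / N) := by field_simp
  have hle : (N : ℝ) ^ p ≤ N := by
    simpa using Real.rpow_le_rpow_of_exponent_le hN' h1
  rw [e, Real.mul_rpow (by positivity) (by positivity)]
  calc (N : ℝ) ^ p * (1 + 1 / N) ^ p - N ^ p ≤ (N : ℝ) ^ p * (1 + p * (1 / N)) - N ^ p := by gcongr
    _ = p * ((N : ℝ) ^ p / N) := by ring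
    _ ≤ p * 1 := by
      gcongr
      exact (div_le_one (by positivity)).2 hle
    _ = p := mul_one p

/-- Here `t` stands for `‖x‖ / δ`, and the first bracket bounds the squared norm of the shifted
point in units of `δ`. For `d = 1` the bracket is `(t - 1)²` and `t ≤ N + 1` is all that is needed.
For `d ≥ 2`, with `P` and `Q` the squared radii, `t² (P - Q) ≤ P / d ≤ P (2t - 1) / d`, because `P -
Q ≤ 2α ≤ 1 / d`, `t² ≤ P` and `t ≥ 1`. -/
theorem shift_scalar_bound {d N : ℕ} (hd : 1 ≤ d) (hN : 1 ≤ N) {t : ℝ} (ht : 1 ≤ t)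
    (ht' : t ≤ ((N : ℝ) + 1) ^ decayExponent d) :
    (t ^ 2 - 2 * t / d + 1 / d) * (((N : ℝ) + 1) ^ decayExponent d) ^ 2 ≤
      t ^ 2 * ((N : ℝ) ^ decayExponent d) ^ 2 := by
  have hN' : (1 : ℝ) ≤ N := by exact_mod_cast hN
  rcases hd.eq_or_lt with rfl | hd2
  · have h1 : decayExponent 1 = 1 := by simp [decayExponent]
    rw [h1] at ht' ⊢
    simp only [Real.rpow_one, Nat.cast_one, div_one] at ht' ⊢
    have h2 : (t - 1) * (N + 1) ≤ t * N := by linarith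
    have h3 : 0 ≤ (t - 1) * ((N : ℝ) + 1) := mul_nonneg (by linarith) (by linarith)
    nlinarith [mul_self_le_mul_self h3 h2]
  · have hd' : (2 : ℝ) ≤ d := by exact_mod_cast hd2
    have hα := decayExponent_pos hd
    have hα2 := two_mul_decayExponent_le hd2
    have hd1 : 1 / (d : ℝ) ≤ 1 := by rw [div_le_one] <;> linarith
    have hpq := add_one_rpow_sub_rpow_le hN (p := 2 * decayExponent d) (by linarith) (by linarith)
    have e (x : ℝ) (hx : 0 ≤ x) : (x ^ decayExponent d) ^ 2 = x ^ (2 * decayExponent d) := by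
      rw [← Real.rpow_natCast, ← Real.rpow_mul hx, mul_comm]; norm_num
    rw [← e _ (by positivity), ← e _ (by positivity)] at hpq
    set P := (((N : ℝ) + 1) ^ decayExponent d) ^ 2 with hP
    set Q := ((N : ℝ) ^ decayExponent d) ^ 2
    have htP : t ^ 2 ≤ P := by rw [hP]; gcongr
    have hPQ : P - Q ≤ 1 / d := hpq.trans hα2
    have hP0 : 0 ≤ P := sq_nonneg _
    have h1 : t ^ 2 * (P - Q) ≤ P * (1 / d) := by
      calc t ^ 2 * (P - Q) ≤ t ^ 2 * (1 / d) := by gcongr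
        _ ≤ _ := by gcongr
    have h2 : P * (1 / d) ≤ P * ((2 * t - 1) / d) := by gcongr; linarith
    have e3 : t ^ 2 - 2 * t / d + 1 / d = t ^ 2 - (2 * t - 1) / d := by ring
    rw [e3]
    linarith

theorem norm_le_sum_of_mem_orthant {d : ℕ} {x : Rd d} (hx : x ∈ orthant d) : ‖x‖ ≤ ∑ i, x i := by
  have h0 : ∀ i ∈ Finset.univ, 0 ≤ x i := fun i _ => hx i
  rw [EuclideanSpace.norm_eq]
  refine Real.sqrt_le_left (Finset.sum_nonneg h0) |>.2 ?_
  simpa using Finset.sum_sq_le_sq_sum_of_nonneg h0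

theorem norm_sub_const_sq {d : ℕ} (x : Rd d) (c : ℝ) :
    ‖x - WithLp.toLp 2 (fun _ => c)‖ ^ 2 = ‖x‖ ^ 2 - 2 * c * ∑ i, x i + d * c ^ 2 := by
  rw [EuclideanSpace.norm_sq_eq, EuclideanSpace.norm_sq_eq, Finset.mul_sum]
  simp only [PiLp.sub_apply, Real.norm_eq_abs, sq_abs, sub_sq, Finset.sum_add_distrib,
    Finset.sum_sub_distrib]
  simp only [Finset.sum_const, Finset.card_univ, Fintype.card_fin, nsmul_eq_mul]
  congr 2
  exact Finset.sum_congr rfl fun i _ => by ring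

theorem norm_shift_le {d N : ℕ} (hd : 1 ≤ d) (hN : 1 ≤ N) {δ : ℝ} (hδ : 0 < δ) {x : Rd d}
    (hx : x ∈ orthant d) (h1 : δ ≤ ‖x‖) (h2 : ‖x‖ ≤ ((N : ℝ) + 1) ^ decayExponent d * δ) :
    ‖x - WithLp.toLp 2 (fun _ => δ / d)‖ / ((N : ℝ) ^ decayExponent d * δ) ≤
      ‖x‖ / (((N : ℝ) + 1) ^ decayExponent d * δ) := by
  have hN' : (1 : ℝ) ≤ N := by exact_mod_cast hN
  have hd' : (1 : ℝ) ≤ d := by exact_mod_cast hd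
  have hb := shift_scalar_bound hd hN (t := ‖x‖ / δ) ((one_le_div hδ).2 h1)
    ((div_le_iff₀ hδ).2 h2)
  have hQ : 0 < (N : ℝ) ^ decayExponent d := by positivity
  have hP : 0 < ((N : ℝ) + 1) ^ decayExponent d := by positivity
  set P := ((N : ℝ) + 1) ^ decayExponent d
  set Q := (N : ℝ) ^ decayExponent d
  have hs := norm_le_sum_of_mem_orthant hx
  have hn := norm_sub_const_sq x (δ / d)
  have hle : ‖x - WithLp.toLp 2 (fun _ => δ / d)‖ ^ 2 ≤
      δ ^ 2 * ((‖x‖ / δ) ^ 2 - 2 * (‖x‖ / δ) / d + 1 / d) := by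
    rw [hn]
    -- In the orthant the Euclidean norm is at most the coordinate sum, so the diagonal shift has a
    -- large inner product with `x`.
    have : 2 * (δ / d) * ‖x‖ ≤ 2 * (δ / d) * ∑ i, x i := by gcongr
    have e : δ ^ 2 * ((‖x‖ / δ) ^ 2 - 2 * (‖x‖ / δ) / d + 1 / d) =
        ‖x‖ ^ 2 - 2 * (δ / d) * ‖x‖ + d * (δ / d) ^ 2 := by
      field_simp
    linarith
  rw [div_le_div_iff₀ (by positivity) (by positivity)]
  refine abs_le_of_sq_le_sq' ?_ (by positivity) |>.2
  calc _ = ‖x - WithLp.toLp 2 (fun _ => δ / d)‖ ^ 2 * (P ^ 2 * δ ^ 2) := by ring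
    _ ≤ δ ^ 2 * ((‖x‖ / δ) ^ 2 - 2 * (‖x‖ / δ) / d + 1 / d) * (P ^ 2 * δ ^ 2) := by gcongr
    _ = ((‖x‖ / δ) ^ 2 - 2 * (‖x‖ / δ) / d + 1 / d) * P ^ 2 * δ ^ 4 := by ring
    _ ≤ (‖x‖ / δ) ^ 2 * Q ^ 2 * δ ^ 4 := by gcongr
    _ = _ := by field_simp

theorem rHat_nonneg {d : ℕ} (l : ℝ) (w : Rd d) : 0 ≤ rHat l w :=
  Real.rpow_nonneg (le_max_left _ _) _

theorem rHat_le_one {d : ℕ} {l : ℝ} (hl : 0 ≤ l) (w : Rd d) : rHat l w ≤ 1 :=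
  Real.rpow_le_one (le_max_left _ _) (max_le zero_le_one (by linarith [norm_nonneg w])) hl

theorem rHat_eq_zero {d : ℕ} {l : ℝ} (hl : 0 < l) {w : Rd d} (hw : 1 ≤ ‖w‖) : rHat l w = 0 := by
  rw [rHat, max_eq_left (by linarith), Real.zero_rpow hl.ne']

theorem rHat_le_rHat {d : ℕ} {l : ℝ} (hl : 0 ≤ l) {w w' : Rd d} (h : ‖w'‖ ≤ ‖w‖) :
    rHat l w ≤ rHat l w' :=
  Real.rpow_le_rpow (le_max_left _ _) (max_le_max le_rfl (by linarith)) hl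

theorem continuous_rHat {d : ℕ} {l : ℝ} (hl : 0 ≤ l) : Continuous (rHat l : Rd d → ℝ) :=
  (continuous_const.max (continuous_const.sub continuous_norm)).rpow_const fun _ => Or.inr hl

/-- For every rotated orthant there is a frequency shift which compensates the passage from
dilation factor `N ^ α δ` to `(N + 1) ^ α δ` outside of the spectral gap. -/
theorem exists_shift {d N : ℕ} (hd : 1 ≤ d) (hN : 1 ≤ N) {δ l : ℝ} (hδ : 0 < δ) (hl : 0 < l)
    (R : Rd d ≃ₗᵢ[ℝ] Rd d) :
    ∃ ν : Rd d, ∀ w ∈ R '' orthant d, δ ≤ ‖w‖ →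
      rHat l ((((N + 1 : ℕ) : ℝ) ^ decayExponent d * δ)⁻¹ • w) ≤
        rHat l (((N : ℝ) ^ decayExponent d * δ)⁻¹ • (w - ν)) := by
  refine ⟨R (WithLp.toLp 2 (fun _ => δ / d)), ?_⟩
  rintro _ ⟨x, hx, rfl⟩ h1
  have hN' : (1 : ℝ) ≤ N := by exact_mod_cast hN
  rw [R.norm_map] at h1
  push_cast
  have hP : 0 < ((N : ℝ) + 1) ^ decayExponent d * δ := by positivity
  have hQ : 0 < (N : ℝ) ^ decayExponent d * δ := by positivity
  have hnorm {c : ℝ} (hc : 0 < c) (y : Rd d) : ‖c⁻¹ • y‖ = ‖y‖ / c := by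
    rw [norm_smul, norm_inv, Real.norm_of_nonneg hc.le, div_eq_inv_mul]
  -- Beyond the larger radius the left-hand side vanishes; the norm comparison is needed only below
  -- it.
  rcases le_or_gt (((N : ℝ) + 1) ^ decayExponent d * δ) ‖x‖ with h | h
  · rw [rHat_eq_zero hl]
    · exact rHat_nonneg _ _
    · rwa [hnorm hP, R.norm_map, one_le_div hP]
  · refine rHat_le_rHat hl.le ?_
    rw [hnorm hP, hnorm hQ, ← map_sub, R.norm_map, R.norm_map]
    exact norm_shift_le hd hN hδ hx h1 h.le

end OrthantShift

/-! ### Weighted energy estimates for one layer -/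

section Layers

variable {d : ℕ}

/-- The energy of the spectrum of `F` with respect to the weight `u`. -/
noncomputable def spectralEnergy (u : Rd d → ℝ≥0∞) (F : L2 d) : ℝ≥0∞ :=
  ∫⁻ w, ‖(𝓕 F : L2 d) w‖ₑ ^ 2 * u w

theorem measurable_enorm_fourier_sq (F : L2 d) :
    Measurable fun w => ‖(𝓕 F : L2 d) w‖ₑ ^ 2 :=
  (Lp.stronglyMeasurable _).measurable.enorm.pow_const _

theorem spectralEnergy_one (F : L2 d) : spectralEnergy 1 F = energy F := by
  rw [← energy_fourier, energy_eq_lintegral]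
  simp [spectralEnergy]

theorem energy_ofReal_norm (f : Rd d → ℂ) : energy (fun x => ((‖f x‖ : ℝ) : ℂ)) = energy f := by
  simp [energy_eq_lintegral, enorm_eq_nnnorm]

theorem energy_modulus (F : L2 d) : energy (modulus F) = energy F := by
  rw [modulus, energy_congr_ae (Lp.memLp F).ofReal_norm.coeFn_toLp, energy_ofReal_norm]

theorem spectralEnergy_add_one_sub {v : Rd d → ℝ} (hv : Measurable v) (h0 : ∀ w, 0 ≤ v w)
    (h1 : ∀ w, v w ≤ 1) (F : L2 d) :
    spectralEnergy (fun w => ENNReal.ofReal (1 - v w)) F +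
      spectralEnergy (fun w => ENNReal.ofReal (v w)) F = energy F := by
  have hm : Measurable fun w => ‖(𝓕 F : L2 d) w‖ₑ ^ 2 * ENNReal.ofReal (1 - v w) :=
    (measurable_enorm_fourier_sq F).mul (by fun_prop)
  rw [← spectralEnergy_one, spectralEnergy, spectralEnergy, spectralEnergy, ← lintegral_add_left hm]
  refine lintegral_congr fun w => ?_
  rw [← mul_add, ← ENNReal.ofReal_add (by linarith [h1 w]) (h0 w), sub_add_cancel]
  simp

/-- If the low-pass weight `v` is modulus monotone, then the modulus decreases the energy with
respect to the complementary weight. -/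
theorem spectralEnergy_modulus_le {v : Rd d → ℝ} (hv : Measurable v) (h0 : ∀ w, 0 ≤ v w)
    (h1 : ∀ w, v w ≤ 1) (hmono : ModulusMonotone fun w => ENNReal.ofReal (v w)) (F : L2 d)
    (ν : Rd d) :
    spectralEnergy (fun w => ENNReal.ofReal (1 - v w)) (modulus F) ≤
      spectralEnergy (fun w => ENNReal.ofReal (1 - v (w - ν))) F := by
  -- Low-pass and high-pass parts add up to the same finite energy for `F` and for its modulus, so a
  -- gain in the former is a loss in the latter.
  have e1 := spectralEnergy_add_one_sub hv h0 h1 (modulus F)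
  have e2 := spectralEnergy_add_one_sub (v := fun w => v (w - ν)) (by fun_prop) (fun _ => h0 _)
    (fun _ => h1 _) F
  have hle : spectralEnergy (fun w => ENNReal.ofReal (v (w - ν))) F ≤
    spectralEnergy (fun w => ENNReal.ofReal (v w)) (modulus F) := hmono F ν
  have hfin : energy F ≠ ∞ := energy_ne_top (Lp.memLp F)
  rw [energy_modulus, ← e2] at e1
  have hfin' : spectralEnergy (fun w => ENNReal.ofReal (v (w - ν))) F ≠ ∞ :=
    ne_top_of_le_ne_top hfin (by rw [← e2]; exact le_add_self)
  refine (ENNReal.add_le_add_iff_right hfin').1 ?_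
  rw [← e1]
  gcongr

/-- The high-pass weight `1 - |r̂_l(ω / (Nᵅ δ))|²`. -/
noncomputable def highPassWeight (δ l : ℝ) (N : ℕ) (w : Rd d) : ℝ :=
  1 - |rHat l (((N : ℝ) ^ decayExponent d * δ)⁻¹ • w)| ^ 2

theorem rHat_sq_le_one {l : ℝ} (hl : 0 ≤ l) (w : Rd d) : |rHat l w| ^ 2 ≤ 1 := by
  rw [abs_of_nonneg (rHat_nonneg _ _)]
  exact pow_le_one₀ (rHat_nonneg _ _) (rHat_le_one hl w)

theorem highPassWeight_nonneg {l : ℝ} (hl : 0 ≤ l) (δ : ℝ) (N : ℕ) (w : Rd d) :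
    0 ≤ highPassWeight δ l N w :=
  sub_nonneg.2 (rHat_sq_le_one hl _)

theorem highPassWeight_le_one (δ l : ℝ) (N : ℕ) (w : Rd d) : highPassWeight δ l N w ≤ 1 :=
  sub_le_self _ (sq_nonneg _)

theorem continuous_highPassWeight {l : ℝ} (hl : 0 ≤ l) (δ : ℝ) (N : ℕ) :
    Continuous (highPassWeight δ l N : Rd d → ℝ) :=
  continuous_const.sub (((continuous_rHat hl).comp (continuous_const_smul _)).abs.pow 2)

namespace ModuleSequence

variable (Ω : ModuleSequence d)

/-- The convolution of `F` with the filter `g n lam`, as an element of `L²`. -/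
noncomputable def filtered (n : ℕ) (lam : Ω.Λ n) (F : L2 d) : L2 d :=
  (memLp_conv_coe F (Ω.integrable_g n lam) (Ω.memLp_g n lam)).toLp _

theorem spectralEnergy_filtered (n : ℕ) (lam : Ω.Λ n) (F : L2 d) (u : Rd d → ℝ≥0∞) :
    spectralEnergy u (Ω.filtered n lam F) =
      ∫⁻ w, ‖(𝓕 F : L2 d) w‖ₑ ^ 2 * ‖𝓕 (Ω.g n lam) w‖ₑ ^ 2 * u w := by
  refine lintegral_congr_ae ?_
  filter_upwards [coeFn_fourier_conv F (Ω.integrable_g n lam) (Ω.memLp_g n lam)] with w hw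
  rw [filtered, hw, enorm_mul, mul_pow]

/-- The upper frame bound holds for every spectral weight. -/
theorem tsum_spectralEnergy_filtered_le (n : ℕ) (F : L2 d) {v : Rd d → ℝ} (hv : Measurable v)
    (h0 : ∀ w, 0 ≤ v w) (h1 : ∀ w, v w ≤ 1) :
    ∑' lam, spectralEnergy (fun w => ENNReal.ofReal (v w)) (Ω.filtered n lam F) ≤
      ENNReal.ofReal (Ω.B n) * spectralEnergy (fun w => ENNReal.ofReal (v w)) F := by
  have hm : MemLp (fun w => ((√(v w) : ℝ) : ℂ) * (𝓕 F : L2 d) w) 2 volume := by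
    refine (Lp.memLp (𝓕 F : L2 d)).mono (AEStronglyMeasurable.mul
      (Measurable.aestronglyMeasurable (by fun_prop)) (Lp.memLp _).1) (ae_of_all _ fun w => ?_)
    rw [norm_mul, Complex.norm_real, Real.norm_of_nonneg (Real.sqrt_nonneg _)]
    exact mul_le_of_le_one_left (norm_nonneg _) (Real.sqrt_le_one.2 (h1 w))
  -- The multiplier `√v` moves the weight into the signal, so that the frame bound for `F'` is the
  -- weighted bound for `F`.
  set F' : L2 d := 𝓕⁻ (hm.toLp _) with hF'
  have hspec : (fun w => ‖(𝓕 F' : L2 d) w‖ₑ ^ 2) =ᵐ[volume]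
      fun w => ‖(𝓕 F : L2 d) w‖ₑ ^ 2 * ENNReal.ofReal (v w) := by
    rw [hF', FourierTransform.fourier_fourierInv_eq]
    filter_upwards [hm.coeFn_toLp] with w hw
    rw [hw, enorm_mul, mul_pow, mul_comm, enorm_sq_eq_ofReal, enorm_sq_eq_ofReal,
      Complex.norm_real, Real.norm_of_nonneg (Real.sqrt_nonneg _), Real.sq_sqrt (h0 w)]
  have hup := le_add_self.trans (Ω.frame_upper n F')
  have e1 (lam : Ω.Λ n) : energy (conv F' (Ω.g n lam)) =
      spectralEnergy (fun w => ENNReal.ofReal (v w)) (Ω.filtered n lam F) := by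
    rw [energy_conv_coe _ (Ω.integrable_g n lam) (Ω.memLp_g n lam), spectralEnergy_filtered]
    refine lintegral_congr_ae ?_
    filter_upwards [hspec] with w hw
    rw [hw, mul_right_comm]
  have e2 : energy F' = spectralEnergy (fun w => ENNReal.ofReal (v w)) F := by
    rw [← energy_fourier, energy_eq_lintegral]
    exact lintegral_congr_ae hspec
  simpa only [e1, e2] using hup

theorem ae_le_norm_of_fourier_ne_zero {δ : ℝ} (hgap : Ω.HighPass δ) (n : ℕ) (lam : Ω.Λ n) :
    ∀ᵐ w ∂(volume : Measure (Rd d)), 𝓕 (Ω.g n lam) w ≠ 0 → δ ≤ ‖w‖ := by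
  filter_upwards [hgap n] with w hw hne
  by_contra hlt
  have h := ENNReal.tsum_eq_zero.1 (hw (mem_ball_zero_iff.2 (not_le.1 hlt))) lam
  simp [hne] at h

/-- For index `1` the cut-off radius is `δ`, so the high-pass weight equals `1` wherever a filter is
nonzero, up to null sets. -/
theorem tsum_energy_filtered_le {δ l : ℝ} (hδ : 0 < δ) (hl : 0 < l) (hgap : Ω.HighPass δ) (n : ℕ)
    (F : L2 d) :
    ∑' lam, spectralEnergy 1 (modulus (Ω.filtered n lam F)) ≤
      ENNReal.ofReal (max 1 (Ω.B n)) *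
        spectralEnergy (fun w => ENNReal.ofReal (highPassWeight δ l 1 w)) F := by
  refine le_trans (le_trans (ENNReal.tsum_le_tsum fun lam => ?_)
    (Ω.tsum_spectralEnergy_filtered_le n F (continuous_highPassWeight hl.le δ 1).measurable
      (highPassWeight_nonneg hl.le δ 1) (highPassWeight_le_one δ l 1))) ?_
  · rw [spectralEnergy_one, energy_modulus, ← spectralEnergy_one, spectralEnergy_filtered,
      spectralEnergy_filtered]
    refine lintegral_mono_ae ?_
    filter_upwards [Ω.ae_le_norm_of_fourier_ne_zero hgap n lam] with w hw
    by_cases h : 𝓕 (Ω.g n lam) w = 0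
    · simp [h]
    · have : highPassWeight δ l 1 w = 1 := by
        rw [highPassWeight, rHat_eq_zero hl]
        · simp
        · rw [norm_smul]
          simpa [abs_of_pos hδ, ← div_eq_inv_mul, one_le_div hδ] using hw h
      simp [this]
  · gcongr
    exact le_max_right _ _

/-- The shift `ν` depends on the filter, but the weight of index `N + 1` that dominates after the
shift does not. The sum over all filters can therefore be controlled by a single use of the frame
bound. -/
theorem tsum_spectralEnergy_modulus_filtered_le (hd : 1 ≤ d) {δ l : ℝ} (hδ : 0 < δ)
    (hl : ((d / 2 : ℕ) : ℝ) + 1 < l) (hΩ : Ω.Analytic) (hgap : Ω.HighPass δ) (n : ℕ) {N : ℕ}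
    (hN : 1 ≤ N) (F : L2 d) :
    ∑' lam, spectralEnergy (fun w => ENNReal.ofReal (highPassWeight δ l N w))
        (modulus (Ω.filtered n lam F)) ≤
      ENNReal.ofReal (max 1 (Ω.B n)) *
        spectralEnergy (fun w => ENNReal.ofReal (highPassWeight δ l (N + 1) w)) F := by
  have hl0 : 0 < l := by
    have : (0 : ℝ) ≤ ((d / 2 : ℕ) : ℝ) := Nat.cast_nonneg _
    linarith
  have hN' : (1 : ℝ) ≤ N := by exact_mod_cast hN
  refine le_trans (le_trans (ENNReal.tsum_le_tsum fun lam => ?_)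
    (Ω.tsum_spectralEnergy_filtered_le n F (continuous_highPassWeight hl0.le δ (N + 1)).measurable
      (highPassWeight_nonneg hl0.le δ (N + 1)) (highPassWeight_le_one δ l (N + 1)))) ?_
  · obtain ⟨R, hR⟩ := hΩ n lam
    obtain ⟨ν, hν⟩ := exists_shift hd hN hδ hl0 R
    have hgood := modulusMonotone_rHat_sq hd hl
      (R := (N : ℝ) ^ decayExponent d * δ) (by positivity)
    refine (spectralEnergy_modulus_le
      (v := fun w => |rHat l (((N : ℝ) ^ decayExponent d * δ)⁻¹ • w)| ^ 2)
      (((continuous_rHat hl0.le).comp (continuous_const_smul _)).abs.pow 2).measurable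
      (fun w => sq_nonneg _) (fun w => rHat_sq_le_one hl0.le _) hgood
      (Ω.filtered n lam F) ν).trans ?_
    rw [spectralEnergy_filtered, spectralEnergy_filtered]
    refine lintegral_mono_ae ?_
    filter_upwards [Ω.ae_le_norm_of_fourier_ne_zero hgap n lam] with w hw
    by_cases h : 𝓕 (Ω.g n lam) w = 0
    · simp [h]
    · gcongr
      have h1 := hν w (hR (subset_tsupport _ h)) (hw h)
      rw [highPassWeight, abs_of_nonneg (rHat_nonneg _ _), abs_of_nonneg (rHat_nonneg _ _)]
      have := pow_le_pow_left₀ (rHat_nonneg _ _) h1 2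
      linarith
  · gcongr
    exact le_max_right _ _

end ModuleSequence

end Layers

/-! ### Integrals against the high-pass weight -/

section HighPassWeight

variable {d : ℕ}

theorem integrable_highPassWeight {l : ℝ} (hl : 0 ≤ l) (δ : ℝ) (N : ℕ) (f : L2 d) :
    Integrable fun w => ‖(𝓕 f : L2 d) w‖ ^ 2 * highPassWeight δ l N w := by
  refine (integrable_powerSpectrum f).mul_bdd (c := 1)
    (continuous_highPassWeight hl δ N).aestronglyMeasurable (ae_of_all _ fun w => ?_)
  rw [Real.norm_of_nonneg (highPassWeight_nonneg hl δ N w)]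
  exact highPassWeight_le_one δ l N w

theorem spectralEnergy_highPassWeight {l : ℝ} (hl : 0 ≤ l) (δ : ℝ) (N : ℕ) (f : L2 d) :
    spectralEnergy (fun w => ENNReal.ofReal (highPassWeight δ l N w)) f =
      ENNReal.ofReal (∫ w, ‖(𝓕 f : L2 d) w‖ ^ 2 * highPassWeight δ l N w) := by
  rw [ofReal_integral_eq_lintegral_ofReal (integrable_highPassWeight hl δ N f)
    (ae_of_all _ fun w => mul_nonneg (sq_nonneg _) (highPassWeight_nonneg hl δ N w))]
  refine lintegral_congr fun w => ?_
  rw [ENNReal.ofReal_mul (sq_nonneg _), enorm_sq_eq_ofReal]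

/-- The exponent `α` is positive, so the cut-off radius tends to infinity and the weight to zero
pointwise; the power spectrum is a dominating function. -/
theorem tendsto_integral_highPassWeight (hd : 1 ≤ d) {δ l : ℝ} (hδ : 0 < δ) (hl : 0 < l)
    (f : L2 d) :
    Tendsto (fun N : ℕ => ∫ w, ‖(𝓕 f : L2 d) w‖ ^ 2 * highPassWeight δ l N w) atTop (𝓝 0) := by
  rw [show (0 : ℝ) = ∫ _ : Rd d, (0 : ℝ) by simp]
  refine tendsto_integral_of_dominated_convergence (powerSpectrum f)
    (fun N => (integrable_highPassWeight hl.le δ N f).aestronglyMeasurable)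
    (integrable_powerSpectrum f) (fun N => ae_of_all _ fun w => ?_) (ae_of_all _ fun w => ?_)
  · rw [Real.norm_of_nonneg (mul_nonneg (sq_nonneg _) (highPassWeight_nonneg hl.le δ N w))]
    exact mul_le_of_le_one_right (sq_nonneg _) (highPassWeight_le_one δ l N w)
  · have h1 : Tendsto (fun N : ℕ => ((N : ℝ) ^ decayExponent d * δ)⁻¹ • w) atTop (𝓝 0) := by
      have h2 : Tendsto (fun N : ℕ => ((N : ℝ) ^ decayExponent d * δ)⁻¹) atTop (𝓝 0) :=
        tendsto_inv_atTop_zero.comp (((tendsto_rpow_atTop (decayExponent_pos hd)).comp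
          tendsto_natCast_atTop_atTop).atTop_mul_const hδ)
      simpa using h2.smul_const w
    have h3 : Tendsto (fun v : Rd d => 1 - |rHat l v| ^ 2) (𝓝 0) (𝓝 0) := by
      have hc : Continuous fun v : Rd d => 1 - |rHat l v| ^ 2 :=
        continuous_const.sub ((continuous_rHat hl.le).abs.pow 2)
      have := hc.tendsto 0
      simpa [rHat] using this
    have h4 := (h3.comp h1).const_mul (‖(𝓕 f : L2 d) w‖ ^ 2)
    rwa [mul_zero] at h4

theorem energy_eq_zero_iff (f : L2 d) : energy f = 0 ↔ f = 0 := by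
  rw [energy, pow_eq_zero_iff two_ne_zero, eLpNorm_eq_zero_iff (Lp.memLp f).1 two_ne_zero,
    Lp.eq_zero_iff_ae_eq_zero]

end HighPassWeight

/-! ### Iteration over the layers -/

namespace ModuleSequence

variable {d : ℕ} (Ω : ModuleSequence d)

theorem tsum_path_succ (n : ℕ) (H : Ω.Path n → Ω.Λ n → ℝ≥0∞) :
    ∑' q : Ω.Path (n + 1), H (fun k => q k.castSucc) (q (Fin.last n)) =
      ∑' p : Ω.Path n, ∑' lam : Ω.Λ n, H p lam := by
  have h := (Fin.snocEquiv (fun k : Fin (n + 1) => Ω.Λ k)).symm.tsum_eq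
    (fun x => H x.2 x.1)
  rw [ENNReal.tsum_comm, ← ENNReal.tsum_prod (f := fun lam p => H p lam)]
  exact h

theorem memLp_U {f : Rd d → ℂ} (hf : MemLp f 2 volume) (n : ℕ) (q : Ω.Path n) :
    MemLp (Ω.U n q f) 2 volume := by
  induction n with
  | zero => exact hf
  | succ n ih => exact (memLp_conv (ih _) (Ω.integrable_g _ _) (Ω.memLp_g _ _)).ofReal_norm

/-- The signal `U[q] f` as an element of `L²`. -/
noncomputable def propagated (n : ℕ) (q : Ω.Path n) (f : L2 d) : L2 d :=
  (Ω.memLp_U (Lp.memLp f) n q).toLp _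

theorem coeFn_propagated (n : ℕ) (q : Ω.Path n) (f : L2 d) :
    Ω.propagated n q f =ᵐ[volume] Ω.U n q f :=
  MemLp.coeFn_toLp _

theorem propagated_succ (n : ℕ) (q : Ω.Path (n + 1)) (f : L2 d) :
    Ω.propagated (n + 1) q f =
      modulus (Ω.filtered n (q (Fin.last n)) (Ω.propagated n (fun k => q k.castSucc) f)) := by
  rw [propagated, modulus, MemLp.toLp_eq_toLp_iff]
  filter_upwards [(memLp_conv_coe (Ω.propagated n (fun k => q k.castSucc) f)
    (Ω.integrable_g n (q (Fin.last n))) (Ω.memLp_g n (q (Fin.last n)))).coeFn_toLp] with x hx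
  rw [filtered, hx, conv_congr_left (Ω.coeFn_propagated n _ f)]
  rfl

/-- The weighted spectral energy of all signals propagated to layer `n`. -/
noncomputable def pathEnergy (u : Rd d → ℝ≥0∞) (n : ℕ) (f : L2 d) : ℝ≥0∞ :=
  ∑' q : Ω.Path n, spectralEnergy u (Ω.propagated n q f)

theorem pathEnergy_zero (u : Rd d → ℝ≥0∞) (f : L2 d) :
    Ω.pathEnergy u 0 f = spectralEnergy u f := by
  have h (q : Ω.Path 0) : Ω.propagated 0 q f = f := Lp.toLp_coeFn f _
  simp [pathEnergy, h]

theorem W_eq_pathEnergy (n : ℕ) (f : L2 d) : Ω.W n f = Ω.pathEnergy 1 n f := by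
  refine tsum_congr fun q => ?_
  rw [spectralEnergy_one, energy_congr_ae (Ω.coeFn_propagated n q f)]

theorem pathEnergy_succ_le {u u' : Rd d → ℝ≥0∞} {n : ℕ} {C : ℝ≥0∞}
    (h : ∀ F : L2 d, ∑' lam, spectralEnergy u (modulus (Ω.filtered n lam F)) ≤
      C * spectralEnergy u' F) (f : L2 d) :
    Ω.pathEnergy u (n + 1) f ≤ C * Ω.pathEnergy u' n f := by
  simp only [pathEnergy, propagated_succ]
  rw [Ω.tsum_path_succ n fun p lam =>
    spectralEnergy u (modulus (Ω.filtered n lam (Ω.propagated n p f))), ← ENNReal.tsum_mul_left]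
  exact ENNReal.tsum_le_tsum fun p => h _

/-- The index of the weight counts the layers still to come: it is `1` at the last layer and grows
towards the input. Hence the induction on that number, with the starting layer `n` left general. -/
theorem W_add_le (hd : 1 ≤ d) {δ l : ℝ} (hδ : 0 < δ) (hl : ((d / 2 : ℕ) : ℝ) + 1 < l)
    (hΩ : Ω.Analytic) (hgap : Ω.HighPass δ) (f : L2 d) (N n : ℕ) :
    Ω.W (n + (N + 1)) f ≤ ENNReal.ofReal (∏ k ∈ Finset.range (N + 1), max 1 (Ω.B (n + k))) *
      Ω.pathEnergy (fun w => ENNReal.ofReal (highPassWeight δ l (N + 1) w)) n f := by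
  have hl0 : 0 < l := by
    have : (0 : ℝ) ≤ ((d / 2 : ℕ) : ℝ) := Nat.cast_nonneg _
    linarith
  induction N generalizing n with
  | zero =>
    rw [W_eq_pathEnergy]
    simpa using Ω.pathEnergy_succ_le (Ω.tsum_energy_filtered_le hδ hl0 hgap n) f
  | succ N ih =>
    have h1 := ih (n + 1)
    have h2 := Ω.pathEnergy_succ_le
      (Ω.tsum_spectralEnergy_modulus_filtered_le hd hδ hl hΩ hgap n (N := N + 1) (by omega)) f
    rw [Finset.prod_range_succ', add_zero, ENNReal.ofReal_mul (by positivity), mul_assoc]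
    have e : n + (N + 1 + 1) = n + 1 + (N + 1) := by ring
    rw [e]
    refine h1.trans ?_
    have e2 (k : ℕ) : n + 1 + k = n + (k + 1) := by ring
    simp only [e2]
    gcongr

theorem upperBound_pos (N : ℕ) : 0 < Ω.upperBound N :=
  Finset.prod_pos fun _ _ => lt_max_of_lt_left one_pos

theorem W_le_spectralEnergy (hd : 1 ≤ d) {δ l : ℝ} (hδ : 0 < δ)
    (hl : ((d / 2 : ℕ) : ℝ) + 1 < l) (hΩ : Ω.Analytic) (hgap : Ω.HighPass δ) (f : L2 d) {N : ℕ}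
    (hN : 1 ≤ N) :
    Ω.W N f ≤ ENNReal.ofReal (Ω.upperBound N) *
      spectralEnergy (fun w => ENNReal.ofReal (highPassWeight δ l N w)) f := by
  obtain ⟨n, rfl⟩ : ∃ n, N = n + 1 := ⟨N - 1, by omega⟩
  have h := Ω.W_add_le hd hδ hl hΩ hgap f n 0
  simpa only [zero_add, pathEnergy_zero, upperBound] using h

theorem W_le_integral (hd : 1 ≤ d) {δ l : ℝ} (hδ : 0 < δ)
    (hl : ((d / 2 : ℕ) : ℝ) + 1 < l) (hΩ : Ω.Analytic) (hgap : Ω.HighPass δ) (f : L2 d) {N : ℕ}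
    (hN : 1 ≤ N) :
    Ω.W N f ≤ ENNReal.ofReal (Ω.upperBound N *
      ∫ w, ‖(𝓕 f : L2 d) w‖ ^ 2 * highPassWeight δ l N w) := by
  have hl0 : 0 ≤ l := by
    have : (0 : ℝ) ≤ ((d / 2 : ℕ) : ℝ) := Nat.cast_nonneg _
    linarith
  rw [ENNReal.ofReal_mul (Ω.upperBound_pos N).le, ← spectralEnergy_highPassWeight hl0 δ N f]
  exact Ω.W_le_spectralEnergy hd hδ hl hΩ hgap f hN

end ModuleSequence

/-! ### Decay rate for Sobolev signals -/

section Sobolev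

variable {d : ℕ}

/-- Up to `x = 1`, Bernoulli gives `p * x`, and `x ≤ x ^ γ`. Beyond it the right-hand side is at
least `1`. -/
theorem one_sub_rpow_le {x p γ : ℝ} (hx : 0 ≤ x) (hp : 1 ≤ p) (hγ : 0 ≤ γ) (hγ1 : γ ≤ 1) :
    1 - max 0 (1 - x) ^ p ≤ p * x ^ γ := by
  rcases le_or_gt x 1 with h | h
  · rw [max_eq_right (by linarith)]
    have hb := one_add_mul_self_le_rpow_one_add (s := -x) (by linarith) hp
    have hxx : x ≤ x ^ γ := by
      rcases hx.eq_or_lt with rfl | hx0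
      · exact Real.rpow_nonneg le_rfl _
      · simpa using Real.rpow_le_rpow_of_exponent_ge hx0 h hγ1
    have e : (1 : ℝ) + -x = 1 - x := by ring
    rw [e] at hb
    nlinarith
  · have h1 : (1 : ℝ) ≤ x ^ γ := Real.one_le_rpow h.le hγ
    have h2 : 0 ≤ max 0 (1 - x) ^ p := Real.rpow_nonneg (le_max_left _ _) _
    nlinarith

/-- The two constraints on `γ` give the exponent `min {1, 2s}`: Bernoulli's bound is linear near
`0`, and `‖w‖ ^ γ` has to be absorbed by `(1 + ‖w‖²)^s`. -/
theorem highPassWeight_le {l γ s δ : ℝ} (hl : 1 ≤ l) (hγ : 0 ≤ γ) (hγ1 : γ ≤ 1)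
    (hγs : γ ≤ 2 * s) (hδ : 0 < δ) {N : ℕ} (hN : 1 ≤ N) (w : Rd d) :
    highPassWeight δ l N w ≤
      2 * l * δ ^ (-γ) * (N : ℝ) ^ (-(γ * decayExponent d)) * (1 + ‖w‖ ^ 2) ^ s := by
  have hN' : (1 : ℝ) ≤ N := by exact_mod_cast hN
  have hR : 0 < (N : ℝ) ^ decayExponent d * δ := by positivity
  set R := (N : ℝ) ^ decayExponent d * δ with hRdef
  have hmax : 0 ≤ max 0 (1 - ‖R⁻¹ • w‖) := le_max_left _ _
  have h1 : highPassWeight δ l N w = 1 - max 0 (1 - ‖R⁻¹ • w‖) ^ (2 * l) := by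
    rw [highPassWeight, rHat, sq_abs, ← Real.rpow_natCast, ← Real.rpow_mul hmax]
    push_cast
    rw [mul_comm l 2]
  have h2 : R ^ (-γ) = δ ^ (-γ) * (N : ℝ) ^ (-(γ * decayExponent d)) := by
    rw [hRdef, Real.mul_rpow (by positivity) hδ.le, ← Real.rpow_mul (by positivity), mul_comm]
    congr 2
    ring
  have h3 : ‖w‖ ^ γ ≤ (1 + ‖w‖ ^ 2) ^ s := by
    have h4 : ‖w‖ ^ γ = (‖w‖ ^ 2) ^ (γ / 2) := by
      rw [← Real.rpow_natCast, ← Real.rpow_mul (norm_nonneg w)]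
      congr 1
      push_cast
      ring
    rw [h4]
    calc (‖w‖ ^ 2) ^ (γ / 2) ≤ (1 + ‖w‖ ^ 2) ^ (γ / 2) :=
          Real.rpow_le_rpow (by positivity) (by linarith) (by positivity)
      _ ≤ _ := Real.rpow_le_rpow_of_exponent_le (by nlinarith [sq_nonneg ‖w‖]) (by linarith)
  rw [h1]
  refine (one_sub_rpow_le (norm_nonneg _) (by linarith) hγ hγ1).trans ?_
  rw [norm_smul, norm_inv, Real.norm_of_nonneg hR.le,
    Real.mul_rpow (by positivity) (norm_nonneg _), Real.inv_rpow hR.le, ← Real.rpow_neg hR.le, h2]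
  calc 2 * l * (δ ^ (-γ) * (N : ℝ) ^ (-(γ * decayExponent d)) * ‖w‖ ^ γ)
      = 2 * l * δ ^ (-γ) * (N : ℝ) ^ (-(γ * decayExponent d)) * ‖w‖ ^ γ := by ring
    _ ≤ _ := by gcongr

theorem spectralEnergy_highPassWeight_le {l γ s δ : ℝ} (hl : 1 ≤ l) (hγ : 0 ≤ γ) (hγ1 : γ ≤ 1)
    (hγs : γ ≤ 2 * s) (hδ : 0 < δ) {N : ℕ} (hN : 1 ≤ N) (f : L2 d) :
    spectralEnergy (fun w => ENNReal.ofReal (highPassWeight δ l N w)) f ≤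
      ENNReal.ofReal (2 * l * δ ^ (-γ) * (N : ℝ) ^ (-(γ * decayExponent d))) *
        ∫⁻ w, ENNReal.ofReal ((1 + ‖w‖ ^ 2) ^ s) * ‖(𝓕 f : L2 d) w‖ₑ ^ 2 := by
  rw [← lintegral_const_mul' _ _ ENNReal.ofReal_ne_top]
  refine lintegral_mono fun w => ?_
  rw [← mul_assoc, mul_comm, ← ENNReal.ofReal_mul (by positivity)]
  gcongr
  exact ENNReal.ofReal_le_ofReal (highPassWeight_le hl hγ hγ1 hγs hδ hN w)

end Sobolev

/-! ### Energy balance and frame bounds of the feature extractor -/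

namespace ModuleSequence

variable {d : ℕ} (Ω : ModuleSequence d)

/-- The energy of the features generated in layer `n`. -/
noncomputable def layerEnergy (n : ℕ) (f : L2 d) : ℝ≥0∞ :=
  ∑' q : Ω.Path n, energy (Ω.feature n q f)

theorem W_zero (f : L2 d) : Ω.W 0 f = energy f := by
  rw [W_eq_pathEnergy, pathEnergy_zero, spectralEnergy_one]

theorem layerEnergy_add_W_succ (n : ℕ) (f : L2 d) :
    Ω.layerEnergy n f + Ω.W (n + 1) f = ∑' q : Ω.Path n,
      (energy (conv (Ω.propagated n q f) (Ω.χ n)) +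
        ∑' lam : Ω.Λ n, energy (conv (Ω.propagated n q f) (Ω.g n lam))) := by
  simp only [conv_congr_left (Ω.coeFn_propagated n _ f)]
  rw [ENNReal.tsum_add]
  congr 1
  rw [← Ω.tsum_path_succ n fun p lam => energy (conv (Ω.U n p f) (Ω.g n lam))]
  exact tsum_congr fun q => energy_ofReal_norm _

theorem le_layerEnergy_add_W_succ (n : ℕ) (f : L2 d) :
    ENNReal.ofReal (Ω.A n) * Ω.W n f ≤ Ω.layerEnergy n f + Ω.W (n + 1) f := by
  rw [layerEnergy_add_W_succ, W, ← ENNReal.tsum_mul_left]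
  refine ENNReal.tsum_le_tsum fun q => ?_
  rw [← energy_congr_ae (Ω.coeFn_propagated n q f)]
  exact Ω.frame_lower n _

theorem layerEnergy_add_W_succ_le (n : ℕ) (f : L2 d) :
    Ω.layerEnergy n f + Ω.W (n + 1) f ≤ ENNReal.ofReal (Ω.B n) * Ω.W n f := by
  rw [layerEnergy_add_W_succ, W, ← ENNReal.tsum_mul_left]
  refine ENNReal.tsum_le_tsum fun q => ?_
  rw [← energy_congr_ae (Ω.coeFn_propagated n q f)]
  exact Ω.frame_upper n _

/-- Each layer's frame inequality acts only on the propagated energy `W N`. The factor has to be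
`min {1, A}` since it also multiplies the features already collected. -/
theorem lowerBound_mul_energy_le (N : ℕ) (f : L2 d) :
    ENNReal.ofReal (Ω.lowerBound N) * energy f ≤
      ∑ n ∈ Finset.range N, Ω.layerEnergy n f + Ω.W N f := by
  induction N with
  | zero => simp [lowerBound, W_zero]
  | succ N ih =>
    have hnn : 0 ≤ min 1 (Ω.A N) := le_min zero_le_one (Ω.A_pos N).le
    rw [lowerBound, Finset.prod_range_succ, mul_comm, ENNReal.ofReal_mul' hnn, ← mul_assoc,
      mul_comm (energy _), Finset.sum_range_succ, add_assoc]
    calc _ ≤ (∑ n ∈ Finset.range N, Ω.layerEnergy n f + Ω.W N f) *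
          ENNReal.ofReal (min 1 (Ω.A N)) := by
          gcongr
          exact ih
      _ ≤ ∑ n ∈ Finset.range N, Ω.layerEnergy n f * 1 + ENNReal.ofReal (Ω.A N) * Ω.W N f := by
          rw [add_mul, Finset.sum_mul, mul_comm (Ω.W N f)]
          gcongr
          · exact ENNReal.ofReal_le_one.2 (min_le_left _ _)
          · exact min_le_right _ _
      _ ≤ _ := by
          simp only [mul_one]
          gcongr
          exact Ω.le_layerEnergy_add_W_succ N f

theorem le_upperBound_mul_energy (N : ℕ) (f : L2 d) :
    ∑ n ∈ Finset.range N, Ω.layerEnergy n f + Ω.W N f ≤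
      ENNReal.ofReal (Ω.upperBound N) * energy f := by
  induction N with
  | zero => simp [upperBound, W_zero]
  | succ N ih =>
    have hnn : 0 ≤ max 1 (Ω.B N) := le_max_of_le_left zero_le_one
    rw [upperBound, Finset.prod_range_succ, mul_comm, ENNReal.ofReal_mul' hnn, ← mul_assoc,
      mul_comm (energy _), Finset.sum_range_succ, add_assoc]
    calc _ ≤ ∑ n ∈ Finset.range N, Ω.layerEnergy n f * 1 + ENNReal.ofReal (Ω.B N) * Ω.W N f := by
          simp only [mul_one]
          gcongr
          exact Ω.layerEnergy_add_W_succ_le N f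
      _ ≤ (∑ n ∈ Finset.range N, Ω.layerEnergy n f + Ω.W N f) *
          ENNReal.ofReal (max 1 (Ω.B N)) := by
          rw [add_mul, Finset.sum_mul, mul_comm (Ω.W N f)]
          gcongr
          · exact ENNReal.one_le_ofReal.2 (le_max_left _ _)
          · exact le_max_right _ _
      _ ≤ _ := by
          gcongr
          exact ih

theorem tendsto_W (hd : 1 ≤ d) {δ : ℝ} (hδ : 0 < δ) (hΩ : Ω.Analytic) (hgap : Ω.HighPass δ)
    {BΩ : ℝ} (hB : Tendsto Ω.upperBound atTop (𝓝 BΩ)) (f : L2 d) :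
    Tendsto (fun N => Ω.W N f) atTop (𝓝 0) := by
  -- Any `l` above the threshold `⌊d/2⌋ + 1` would do.
  set l : ℝ := ((d / 2 : ℕ) : ℝ) + 2 with hl
  have hl0 : 0 < l := by positivity
  have h := ENNReal.tendsto_ofReal (hB.mul (tendsto_integral_highPassWeight hd hδ hl0 f))
  rw [mul_zero, ENNReal.ofReal_zero] at h
  refine tendsto_of_tendsto_of_tendsto_of_le_of_le' tendsto_const_nhds h
    (Eventually.of_forall fun _ => zero_le) ?_
  filter_upwards [eventually_ge_atTop 1] with N hN
  exact Ω.W_le_integral hd hδ (by linarith) hΩ hgap f hN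

theorem memLp_feature (f : L2 d) (n : ℕ) (q : Ω.Path n) :
    MemLp (Ω.feature n q f) 2 volume :=
  memLp_conv (Ω.memLp_U (Lp.memLp f) n q) (Ω.integrable_χ n) (Ω.memLp_χ n)

theorem featureEnergy_le {BΩ : ℝ} (hB : Tendsto Ω.upperBound atTop (𝓝 BΩ)) (f : L2 d) :
    Ω.featureEnergy f ≤ ENNReal.ofReal BΩ * energy f := by
  have h1 : Tendsto (fun N => ∑ n ∈ Finset.range N, Ω.layerEnergy n f) atTop
      (𝓝 (Ω.featureEnergy f)) := ENNReal.tendsto_nat_tsum _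
  have h2 : Tendsto (fun N => ENNReal.ofReal (Ω.upperBound N) * energy f) atTop
      (𝓝 (ENNReal.ofReal BΩ * energy f)) :=
    ENNReal.Tendsto.mul_const (ENNReal.tendsto_ofReal hB) (Or.inr (energy_ne_top (Lp.memLp f)))
  exact le_of_tendsto_of_tendsto' h1 h2 fun N =>
    le_self_add.trans (Ω.le_upperBound_mul_energy N f)

theorem le_featureEnergy (hd : 1 ≤ d) {δ : ℝ} (hδ : 0 < δ) (hΩ : Ω.Analytic)
    (hgap : Ω.HighPass δ) {AΩ BΩ : ℝ} (hA : Tendsto Ω.lowerBound atTop (𝓝 AΩ))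
    (hB : Tendsto Ω.upperBound atTop (𝓝 BΩ)) (f : L2 d) :
    ENNReal.ofReal AΩ * energy f ≤ Ω.featureEnergy f := by
  have h1 : Tendsto (fun N => ∑ n ∈ Finset.range N, Ω.layerEnergy n f) atTop
      (𝓝 (Ω.featureEnergy f)) := ENNReal.tendsto_nat_tsum _
  have h2 : Tendsto (fun N => ENNReal.ofReal (Ω.lowerBound N) * energy f) atTop
      (𝓝 (ENNReal.ofReal AΩ * energy f)) :=
    ENNReal.Tendsto.mul_const (ENNReal.tendsto_ofReal hA) (Or.inr (energy_ne_top (Lp.memLp f)))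
  have h3 := h1.add (Ω.tendsto_W hd hδ hΩ hgap hB f)
  rw [add_zero] at h3
  exact le_of_tendsto_of_tendsto' h2 h3 fun N => Ω.lowerBound_mul_energy_le N f

theorem mem_nullSet_iff (f : L2 d) : f ∈ Ω.nullSet ↔ Ω.featureEnergy f = 0 := by
  simp only [featureEnergy, ENNReal.tsum_eq_zero]
  refine forall_congr' fun n => forall_congr' fun q => ?_
  rw [energy, pow_eq_zero_iff two_ne_zero, eLpNorm_eq_zero_iff (Ω.memLp_feature f n q).1 two_ne_zero]

end ModuleSequence

/-! ### The main theorem -/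

theorem theorem1 (d : ℕ) (hd : 1 ≤ d) (Ω : ModuleSequence d) (hΩ : Ω.Analytic)
    (δ : ℝ) (hδ : 0 < δ) (hgap : Ω.HighPass δ) :
    (∀ l : ℝ, ((d / 2 : ℕ) : ℝ) + 1 < l → ∀ (f : L2 d) (N : ℕ), 1 ≤ N →
      Ω.W N f ≤ ENNReal.ofReal (Ω.upperBound N *
        ∫ ω, ‖(𝓕 f : L2 d) ω‖ ^ 2 *
          (1 - |rHat l (((N : ℝ) ^ decayExponent d * δ)⁻¹ • ω)| ^ 2))) ∧
    (∀ s : ℝ, 0 < s → ∀ f : L2 d, MemHs s f →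
      ∃ C : ℝ, 0 < C ∧ ∃ N₀ : ℕ, ∀ N : ℕ, N₀ ≤ N →
        Ω.W N f ≤ ENNReal.ofReal
          (C * (Ω.upperBound N * (N : ℝ) ^ (-(min 1 (2 * s) * decayExponent d))))) ∧
    (∀ AΩ BΩ : ℝ, 0 < AΩ → Tendsto Ω.lowerBound atTop (𝓝 AΩ) →
      Tendsto Ω.upperBound atTop (𝓝 BΩ) →
      (∀ f : L2 d, ENNReal.ofReal AΩ * energy (f : Rd d → ℂ) ≤ Ω.featureEnergy f ∧
        Ω.featureEnergy f ≤ ENNReal.ofReal BΩ * energy (f : Rd d → ℂ)) ∧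
      Ω.nullSet = {0}) := by
  refine ⟨fun l hl f N hN => Ω.W_le_integral hd hδ hl hΩ hgap f hN, fun s hs f hf => ?_,
    fun AΩ BΩ hA0 hA hB => ⟨fun f => ⟨Ω.le_featureEnergy hd hδ hΩ hgap hA hB f,
      Ω.featureEnergy_le hB f⟩, ?_⟩⟩
  · set I := ∫⁻ w, ENNReal.ofReal ((1 + ‖w‖ ^ 2) ^ s) * ‖(𝓕 f : L2 d) w‖ₑ ^ 2 with hI
    have hIfin : I ≠ ∞ := hf.ne
    set l : ℝ := ((d / 2 : ℕ) : ℝ) + 2 with hl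
    have hd0 : (0 : ℝ) ≤ ((d / 2 : ℕ) : ℝ) := Nat.cast_nonneg _
    set γ := min 1 (2 * s) with hγ
    have hγ0 : 0 ≤ γ := le_min zero_le_one (by linarith)
    -- Adding `1` to the Sobolev integral keeps the constant positive for `f = 0`; the integral
    -- bound requires `N ≥ 1`.
    refine ⟨2 * l * δ ^ (-γ) * (I.toReal + 1), by positivity, 1, fun N hN => ?_⟩
    have hub := Ω.upperBound_pos N
    calc Ω.W N f ≤ ENNReal.ofReal (Ω.upperBound N) *
          (ENNReal.ofReal (2 * l * δ ^ (-γ) * (N : ℝ) ^ (-(γ * decayExponent d))) * I) := by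
          refine (Ω.W_le_spectralEnergy hd hδ (l := l) (by linarith) hΩ hgap f hN).trans ?_
          gcongr
          exact spectralEnergy_highPassWeight_le (by linarith) hγ0 (min_le_left _ _)
            (min_le_right _ _) hδ hN f
      _ = ENNReal.ofReal (Ω.upperBound N *
          (2 * l * δ ^ (-γ) * (N : ℝ) ^ (-(γ * decayExponent d)) * I.toReal)) := by
          rw [ENNReal.ofReal_mul hub.le, ENNReal.ofReal_mul (q := I.toReal) (by positivity),
            ENNReal.ofReal_toReal hIfin]
      _ ≤ _ := by
          refine ENNReal.ofReal_le_ofReal ?_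
          have h0 : 0 ≤ 2 * l * δ ^ (-γ) * (Ω.upperBound N * (N : ℝ) ^ (-(γ * decayExponent d))) := by
            positivity
          linarith
  · ext f
    rw [Ω.mem_nullSet_iff, Set.mem_singleton_iff, ← energy_eq_zero_iff]
    constructor
    · intro h
      have h1 := Ω.le_featureEnergy hd hδ hΩ hgap hA hB f
      rw [h, nonpos_iff_eq_zero, mul_eq_zero] at h1
      exact h1.resolve_left (ENNReal.ofReal_pos.2 hA0).ne'
    · intro h
      have h1 := Ω.featureEnergy_le hB f
      rwa [h, mul_zero, nonpos_iff_eq_zero] at h1
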